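/- Let $k=\mathbb{R}$. A coalgebra $C$ over $\mathbb{R}$ (coassociative and counital) is called a chain coalgebra if its right coideals, i.e. the subspaces $N\subseteq C$ with $\Delta(N)\subseteq N\otimes C$, are linearly ordered by inclusion. For an $\mathbb{R}$-algebra $A$, the finite dual $A^\circ$ is the space of all linear forms $f:A\to\mathbb{R}$ that vanish on some two-sided ideal of $A$ of finite codimension; it is a coalgebra with counit $f\mapsto f(1)$ and with $\Delta(f)=\sum_i g_i\otimes h_i\in A^\circ\otimes A^\circ$ determined by $f(ab)=\sum_i g_i(a)h_i(b)$ for all $a,b\in A$. Let $\alpha$ be complex conjugation and let $\mathbb{C}[[x,\alpha]]$ be the ring of skew power series $\sum_{n\ge 0}a_nx^n$ with $a_n\in\mathbb{C}$ and $xw=\alpha(w)x$ for $w\in\mathbb{C}$. Then the four real coalgebras $$\mathbb{R}[[x]]^\circ,\qquad \mathbb{C}[[x]]^\circ,\qquad \mathbb{C}[[x,\alpha]]^\circ,\qquad \mathbb{H}[[x]]^\circ$$ (where $x$ commutes with the coefficients in $\mathbb{R}[[x]]$, $\mathbb{C}[[x]]$ and $\mathbb{H}[[x]]$) are infinite-dimensional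 chain coalgebras, no two of them are isomorphic, and every infinite-dimensional chain coalgebra over $\mathbb{R}$ is isomorphic, as a coalgebra, to one of them. -/

import Mathlib

open scoped TensorProduct

noncomputable section

/-! ### Right coideals and chain coalgebras -/

/-- A subspace `N` of a coalgebra `C` is a right coideal, i.e. a right subcomodule of `C`,
if `Δ(N) ⊆ N ⊗ C`. -/
def IsRightCoideal (k : Type*) {C : Type*} [Field k] [AddCommGroup C] [Module k C]
    [Coalgebra k C] (N : Submodule k C) : Prop :=
  ∀ x ∈ N, Coalgebra.comul (R := k) x ∈ LinearMap.range (N.subtype.rTensor C)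

/-- A chain coalgebra: the lattice of right coideals is linearly ordered by inclusion. -/
def IsChainCoalgebra (k C : Type*) [Field k] [AddCommGroup C] [Module k C]
    [Coalgebra k C] : Prop :=
  ∀ M N : Submodule k C, IsRightCoideal k M → IsRightCoideal k N → M ≤ N ∨ N ≤ M

/-! ### The finite dual coalgebra of an algebra -/

section Pairing

variable {k V W X Y : Type*} [Field k] [AddCommGroup V] [Module k V] [AddCommMonoid W]
  [Module k W]

/-- The map `V ⊗ W → (X × Y → k)`, `v ⊗ w ↦ ((x, y) ↦ p v x * q w y)`. -/
def tensorPairing (p : V →ₗ[k] X → k) (q : W →ₗ[k] Y → k) : V ⊗[k] W →ₗ[k] X × Y → k :=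
  TensorProduct.lift (LinearMap.mk₂ k (fun v w (z : X × Y) => p v z.1 * q w z.2)
    (fun v v' w => by ext z; simp [add_mul])
    (fun c v w => by ext z; simp [mul_assoc])
    (fun v w w' => by ext z; simp [mul_add])
    (fun c v w => by ext z; simp [mul_left_comm]))

@[simp]
lemma tensorPairing_tmul (p : V →ₗ[k] X → k) (q : W →ₗ[k] Y → k) (v : V) (w : W) (z : X × Y) :
    tensorPairing p q (v ⊗ₜ w) z = p v z.1 * q w z.2 := rfl

lemma tensorPairing_injective (p : V →ₗ[k] X → k) (q : W →ₗ[k] Y → k)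
    (hp : Function.Injective p) (hq : Function.Injective q) :
    Function.Injective (tensorPairing p q) := by
  classical
  intro t t' ht
  let b := Module.Basis.ofVectorSpace k V
  let e := TensorProduct.equivFinsuppOfBasisLeft (N := W) b
  obtain ⟨w, rfl⟩ := e.symm.surjective t
  obtain ⟨w', rfl⟩ := e.symm.surjective t'
  have hli : LinearIndependent k (fun i => p (b i)) :=
    b.linearIndependent.map' p (LinearMap.ker_eq_bot.2 hp)
  have hsum : ∀ (u : _ →₀ W) (x : X) (y : Y), tensorPairing p q (e.symm u) (x, y) =
      Finsupp.linearCombination k (fun i => p (b i))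
        (u.mapRange (fun u => q u y) (by simp)) x := by
    intro u x y
    simp only [e]
    rw [TensorProduct.equivFinsuppOfBasisLeft_symm_apply, Finsupp.sum, map_sum,
      Finsupp.linearCombination_apply, Finsupp.sum_mapRange_index (by simp), Finsupp.sum]
    simp [mul_comm]
  congr 1
  have key : ∀ y : Y, w.mapRange (fun u => q u y) (by simp) =
      w'.mapRange (fun u => q u y) (by simp) := by
    intro y
    apply hli
    ext x
    rw [← hsum, ← hsum, ht]
  ext i
  apply hq
  ext y
  simpa using DFunLike.congr_fun (key y) i

end Pairing

section FiniteDual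

variable (k A : Type*) [Field k] [Ring A] [Algebra k A]

/-- The finite dual `A°` of a `k`-algebra `A`: the linear forms on `A` that vanish on some
two-sided ideal of finite codimension. -/
def finiteDual : Submodule k (Module.Dual k A) where
  carrier := {f | ∃ I : Ideal A, I.IsTwoSided ∧ Module.Finite k (A ⧸ I) ∧ ∀ a ∈ I, f a = 0}
  zero_mem' := ⟨⊤, inferInstance, inferInstance, by simp⟩
  add_mem' := by
    rintro f g ⟨I, hI, hI', hf⟩ ⟨J, hJ, hJ', hg⟩
    refine ⟨I ⊓ J, ⟨fun b ha => ⟨I.mul_mem_right b ha.1, J.mul_mem_right b ha.2⟩⟩, ?_, fun a ha => ?_⟩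
    · let φ : A →ₗ[k] (A ⧸ I) × (A ⧸ J) :=
        ((Submodule.mkQ I).restrictScalars k).prod ((Submodule.mkQ J).restrictScalars k)
      have hφ : LinearMap.ker φ = (I ⊓ J).restrictScalars k := by
        ext a
        simp [φ]
      have h1 : Module.Finite k (A ⧸ LinearMap.ker φ) :=
        Module.Finite.equiv φ.quotKerEquivRange.symm
      rw [hφ] at h1
      exact Module.Finite.equiv (Submodule.Quotient.restrictScalarsEquiv k (I ⊓ J))
    · simp [hf a ha.1, hg a ha.2]
  smul_mem' := by
    rintro c f ⟨I, hI, hI', hf⟩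
    exact ⟨I, hI, hI', fun a ha => by simp [hf a ha]⟩

namespace finiteDual

/-- Elements of the finite dual as functions. -/
def ev : finiteDual k A →ₗ[k] A → k where
  toFun f a := f.1 a
  map_add' _ _ := rfl
  map_smul' _ _ := rfl

@[simp]
lemma ev_apply (f : finiteDual k A) (a : A) : ev k A f a = f.1 a := rfl

lemma ev_injective : Function.Injective (ev k A) := fun _ _ h =>
  Subtype.ext (LinearMap.ext fun a => congrFun h a)

/-- The map `A° ⊗ A° → (A × A → k)`, `f ⊗ g ↦ ((a, b) ↦ f a * g b)`. -/
def pairing : finiteDual k A ⊗[k] finiteDual k A →ₗ[k] A × A → k :=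
  tensorPairing (V := finiteDual k A) (W := finiteDual k A) (ev k A) (ev k A)

@[simp]
lemma pairing_tmul (f g : finiteDual k A) (z : A × A) :
    pairing k A (f ⊗ₜ g) z = f.1 z.1 * g.1 z.2 := rfl

lemma pairing_injective : Function.Injective (pairing k A) :=
  tensorPairing_injective (V := finiteDual k A) (W := finiteDual k A) _ _
    (ev_injective k A) (ev_injective k A)

/-- The map `f ↦ ((a, b) ↦ f (a * b))`. -/
def precompMul : finiteDual k A →ₗ[k] A × A → k where
  toFun f z := f.1 (z.1 * z.2)
  map_add' _ _ := rfl
  map_smul' _ _ := rfl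

lemma precompMul_mem (f : finiteDual k A) :
    precompMul k A f ∈ LinearMap.range (pairing k A) := by
  obtain ⟨f, I, hI, hI', hf⟩ := f
  let π : A →ₗ[k] A ⧸ I := (Submodule.mkQ I).restrictScalars k
  have hπ : ∀ a ∈ I, π a = 0 := fun a ha => (Submodule.Quotient.mk_eq_zero I).2 ha
  have hker : ∀ a, π a = 0 → f a = 0 := fun a ha => hf a ((Submodule.Quotient.mk_eq_zero I).1 ha)
  let b := Module.finBasis k (A ⧸ I)
  have hsurj : Function.Surjective π := Submodule.mkQ_surjective I
  choose s hs using fun i => hsurj (b i)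
  let l i : finiteDual k A := ⟨b.coord i ∘ₗ π, I, hI, hI', fun a ha => by simp [hπ a ha]⟩
  let r i : finiteDual k A := ⟨f ∘ₗ LinearMap.mulLeft k (s i), I, hI, hI', fun a ha => by
    simpa using hf _ (I.mul_mem_left _ ha)⟩
  refine ⟨∑ i, l i ⊗ₜ r i, ?_⟩
  ext ⟨x, y⟩
  have hx : x - ∑ i, b.repr (π x) i • s i ∈ I := by
    rw [← Submodule.Quotient.mk_eq_zero I]
    change π _ = 0
    rw [map_sub, map_sum]
    simp [hs, b.sum_repr]
  have h0 := hf _ (I.mul_mem_right y hx)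
  rw [sub_mul, map_sub, sub_eq_zero, Finset.sum_mul, map_sum] at h0
  rw [map_sum, Finset.sum_apply]
  simp [precompMul, l, r, h0]

/-- The comultiplication of `A°`: `Δ f` is the unique element of `A° ⊗ A°` that corresponds to
`(a, b) ↦ f (a * b)`; see `pairing_comul`. -/
def comul : finiteDual k A →ₗ[k] finiteDual k A ⊗[k] finiteDual k A :=
  (LinearEquiv.ofInjective (pairing k A) (pairing_injective k A)).symm.toLinearMap ∘ₗ
    (precompMul k A).codRestrict _ (precompMul_mem k A)

lemma pairing_comul (f : finiteDual k A) (z : A × A) :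
    pairing k A (comul k A f) z = f.1 (z.1 * z.2) := by
  have h := LinearEquiv.apply_symm_apply
    (LinearEquiv.ofInjective (pairing k A) (pairing_injective k A))
    ((precompMul k A).codRestrict _ (precompMul_mem k A) f)
  exact congrFun (congrArg Subtype.val h) z

/-- The counit of `A°`: evaluation at `1`. -/
def counit : finiteDual k A →ₗ[k] k where
  toFun f := f.1 1
  map_add' _ _ := rfl
  map_smul' _ _ := rfl

/-- The map `A° ⊗ (A° ⊗ A°) → (A × (A × A) → k)`. -/
def pairing₃ : finiteDual k A ⊗[k] (finiteDual k A ⊗[k] finiteDual k A) →ₗ[k] A × (A × A) → k :=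
  tensorPairing (V := finiteDual k A) (W := finiteDual k A ⊗[k] finiteDual k A) (ev k A) (pairing k A)

lemma pairing₃_injective : Function.Injective (pairing₃ k A) :=
  tensorPairing_injective (V := finiteDual k A) (W := finiteDual k A ⊗[k] finiteDual k A) _ _
    (ev_injective k A) (pairing_injective k A)

lemma pairing₃_assoc_tmul (t : finiteDual k A ⊗[k] finiteDual k A) (g : finiteDual k A)
    (a b c : A) :
    pairing₃ k A (TensorProduct.assoc k _ _ _ (t ⊗ₜ g)) (a, (b, c)) =
      pairing k A t (a, b) * g.1 c := by
  induction t using TensorProduct.induction_on with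
  | zero => simp
  | tmul f h => simp [pairing₃, mul_assoc]
  | add x y hx hy => simp [TensorProduct.add_tmul, hx, hy, add_mul]

lemma pairing₃_rTensor (t : finiteDual k A ⊗[k] finiteDual k A) (a b c : A) :
    pairing₃ k A (TensorProduct.assoc k _ _ _ ((comul k A).rTensor _ t)) (a, (b, c)) =
      pairing k A t (a * b, c) := by
  induction t using TensorProduct.induction_on with
  | zero => simp
  | tmul f h => simp [pairing₃_assoc_tmul, pairing_comul]
  | add x y hx hy => simp [hx, hy]

lemma pairing₃_lTensor (t : finiteDual k A ⊗[k] finiteDual k A) (a b c : A) :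
    pairing₃ k A ((comul k A).lTensor _ t) (a, (b, c)) = pairing k A t (a, b * c) := by
  induction t using TensorProduct.induction_on with
  | zero => simp
  | tmul f h => simp [pairing₃, pairing_comul]
  | add x y hx hy => simp [hx, hy]

lemma lid_rTensor_counit (t : finiteDual k A ⊗[k] finiteDual k A) (a : A) :
    (TensorProduct.lid k _ ((counit k A).rTensor _ t)).1 a = pairing k A t (1, a) := by
  induction t using TensorProduct.induction_on with
  | zero => simp
  | tmul f h => simp [counit]
  | add x y hx hy => simp [hx, hy]

lemma rid_lTensor_counit (t : finiteDual k A ⊗[k] finiteDual k A) (a : A) :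
    (TensorProduct.rid k _ ((counit k A).lTensor _ t)).1 a = pairing k A t (a, 1) := by
  induction t using TensorProduct.induction_on with
  | zero => simp
  | tmul f h => simp [counit, mul_comm]
  | add x y hx hy => simp [hx, hy]

/-- The coalgebra structure of the finite dual. -/
instance instCoalgebra : Coalgebra k (finiteDual k A) where
  comul := comul k A
  counit := counit k A
  coassoc := by
    refine LinearMap.ext fun f => pairing₃_injective k A ?_
    ext ⟨a, b, c⟩
    have h1 := pairing₃_rTensor k A (comul k A f) a b c
    have h2 := pairing₃_lTensor k A (comul k A f) a b c
    rw [pairing_comul] at h1 h2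
    simp only [LinearMap.comp_apply, LinearEquiv.coe_coe]
    rw [h1, h2, mul_assoc]
  rTensor_counit_comp_comul := by
    refine LinearMap.ext fun f => (TensorProduct.lid k _).injective ?_
    refine Subtype.ext (LinearMap.ext fun a => ?_)
    rw [LinearMap.comp_apply, lid_rTensor_counit, pairing_comul]
    simp
  lTensor_counit_comp_comul := by
    refine LinearMap.ext fun f => (TensorProduct.rid k _).injective ?_
    refine Subtype.ext (LinearMap.ext fun a => ?_)
    rw [LinearMap.comp_apply, rid_lTensor_counit, pairing_comul]
    simp

end finiteDual

end FiniteDual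

/-! ### Skew power series -/

/-- The skew power series ring `D[[x, α]]` of a `k`-algebra `D` with an automorphism `α`: formal
series `∑ aₙ xⁿ` with coefficients written on the left, multiplied by the rule `x w = α(w) x`. -/
@[ext]
structure SkewPowerSeries {k D : Type*} [Field k] [Ring D] [Algebra k D] (α : D ≃ₐ[k] D) where
  /-- The coefficients of a skew power series. -/
  coeff : ℕ → D

namespace SkewPowerSeries

variable {k D : Type*} [Field k] [Ring D] [Algebra k D] {α : D ≃ₐ[k] D}

/-- A skew power series is its sequence of coefficients. -/
def equivFun (α : D ≃ₐ[k] D) : SkewPowerSeries α ≃ (ℕ → D) where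
  toFun := coeff
  invFun := mk
  left_inv _ := rfl
  right_inv _ := rfl

instance : AddCommGroup (SkewPowerSeries α) := (equivFun α).addCommGroup

instance : Module k (SkewPowerSeries α) := (equivFun α).module k

instance : One (SkewPowerSeries α) := ⟨⟨fun n => if n = 0 then 1 else 0⟩⟩

/-- `(∑ aᵢ xⁱ) (∑ bⱼ xʲ) = ∑ₙ (∑_{i+j=n} aᵢ αⁱ(bⱼ)) xⁿ`. -/
instance : Mul (SkewPowerSeries α) :=
  ⟨fun f g => ⟨fun n => ∑ p ∈ Finset.HasAntidiagonal.antidiagonal n,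
        f.coeff p.1 * (α ^ p.1) (g.coeff p.2)⟩⟩

@[simp] lemma coeff_zero (n : ℕ) : (0 : SkewPowerSeries α).coeff n = 0 := rfl

@[simp] lemma coeff_add (f g : SkewPowerSeries α) (n : ℕ) :
    (f + g).coeff n = f.coeff n + g.coeff n := rfl

@[simp] lemma coeff_smul (c : k) (f : SkewPowerSeries α) (n : ℕ) :
    (c • f).coeff n = c • f.coeff n := rfl

lemma coeff_one (n : ℕ) : (1 : SkewPowerSeries α).coeff n = if n = 0 then 1 else 0 := rfl

lemma coeff_mul (f g : SkewPowerSeries α) (n : ℕ) :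
    (f * g).coeff n =
      ∑ p ∈ Finset.HasAntidiagonal.antidiagonal n,
        f.coeff p.1 * (α ^ p.1) (g.coeff p.2) := rfl

instance : Ring (SkewPowerSeries α) where
  __ := (inferInstance : AddCommGroup (SkewPowerSeries α))
  left_distrib f g h := by
    ext n
    simp [coeff_mul, mul_add, Finset.sum_add_distrib]
  right_distrib f g h := by
    ext n
    simp [coeff_mul, add_mul, Finset.sum_add_distrib]
  zero_mul f := by
    ext n
    simp [coeff_mul]
  mul_zero f := by
    ext n
    simp [coeff_mul]
  mul_assoc f g h := by
    ext n
    simp only [coeff_mul, map_sum, Finset.sum_mul, Finset.mul_sum, map_mul]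
    rw [Finset.sum_sigma', Finset.sum_sigma']
    refine Finset.sum_nbij' (fun ⟨⟨_, j⟩, ⟨a, b⟩⟩ => ⟨(a, b + j), (b, j)⟩)
      (fun ⟨⟨i, _⟩, ⟨a, b⟩⟩ => ⟨(i + a, b), (i, a)⟩) ?_ ?_ ?_ ?_ ?_
    · rintro ⟨⟨i, j⟩, ⟨a, b⟩⟩ hp
      simp only [Finset.mem_sigma, Finset.HasAntidiagonal.mem_antidiagonal] at hp ⊢
      constructor <;> lia
    · rintro ⟨⟨i, j⟩, ⟨a, b⟩⟩ hp
      simp only [Finset.mem_sigma, Finset.HasAntidiagonal.mem_antidiagonal] at hp ⊢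
      constructor <;> lia
    · rintro ⟨⟨i, j⟩, ⟨a, b⟩⟩ hp
      simp only [Finset.mem_sigma, Finset.HasAntidiagonal.mem_antidiagonal] at hp
      obtain ⟨-, rfl⟩ := hp
      rfl
    · rintro ⟨⟨i, j⟩, ⟨a, b⟩⟩ hp
      simp only [Finset.mem_sigma, Finset.HasAntidiagonal.mem_antidiagonal] at hp
      obtain ⟨-, rfl⟩ := hp
      rfl
    · rintro ⟨⟨i, j⟩, ⟨a, b⟩⟩ hp
      simp only [Finset.mem_sigma, Finset.HasAntidiagonal.mem_antidiagonal] at hp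
      obtain ⟨-, rfl⟩ := hp
      simp [pow_add, mul_assoc]
  one_mul f := by
    ext n
    rw [coeff_mul, Finset.sum_eq_single (0, n)]
    · simp [coeff_one]
    · rintro ⟨i, j⟩ hp hne
      have : i ≠ 0 := by
        rintro rfl
        simp at hp
        exact hne (by simp [hp])
      simp [coeff_one, this]
    · simp
  mul_one f := by
    ext n
    rw [coeff_mul, Finset.sum_eq_single (n, 0)]
    · simp [coeff_one]
    · rintro ⟨i, j⟩ hp hne
      have : j ≠ 0 := by
        rintro rfl
        simp at hp
        exact hne (by simp [hp])
      simp [coeff_one, this]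
    · simp

instance : Algebra k (SkewPowerSeries α) :=
  Algebra.ofModule
    (fun c f g => by
      ext n
      simp [coeff_mul, Finset.smul_sum])
    (fun c f g => by
      ext n
      simp [coeff_mul, Finset.smul_sum])

end SkewPowerSeries

/-! ### The four real coalgebras -/

/-- The real coalgebra `ℝ[[x]]°`. -/
abbrev RealSeriesDual : Type := finiteDual ℝ (PowerSeries ℝ)

/-- The real coalgebra `ℂ[[x]]°`. -/
abbrev ComplexSeriesDual : Type := finiteDual ℝ (PowerSeries ℂ)

/-- The real coalgebra `ℂ[[x, α]]°`, with `α` complex conjugation. -/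
abbrev SkewComplexSeriesDual : Type := finiteDual ℝ (SkewPowerSeries Complex.conjAe)

/-- The real coalgebra `ℍ[[x]]°`. -/
abbrev QuaternionSeriesDual : Type := finiteDual ℝ (PowerSeries (Quaternion ℝ))

end

noncomputable section

/-! ### The dual algebra of a coalgebra and its actions -/

section Actions

variable {k C : Type*} [Field k] [AddCommGroup C] [Module k C] [Coalgebra k C]

/-! The convolution algebra C* acts on C from both sides, and right coideals are the subspaces
stable under the left action. Every `rightAct g` commutes with that action, so it maps coideals to
coideals and has a coideal as kernel. In a chain coalgebra, comparing dimensions then shows that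
finite-dimensional coideals are subcoalgebras (`IsChainCoalgebra.rightAct_mem`).

Let S be the smallest nonzero coideal and T the next one. The functionals vanishing on S form a
two-sided ideal J of topologically nilpotent elements, and C*/J is a finite-dimensional real
division algebra D, so it is ℝ, ℂ or ℍ by Frobenius. It lifts to a copy of D in C*: square roots of
-1 are corrected by the binomial series of (1+X)^(-1/2) evaluated at an element of J
(`IsSmallestCoideal.exists_mul_self_eq_neg_one`). Some x in J does not vanish on T, and splitting it
into commuting and anticommuting parts makes x w = α(w) x on the lifted D, where α is the identity
or, only for D = ℂ, possibly conjugation.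

Evaluating series at x gives D[[x, α]] → C*, and dually C → D[[x, α]]°. This map is injective
because the kernel of the right action of x lies in S. It is surjective because its image is an
infinite-dimensional coideal of a chain coalgebra (`nonempty_coalgEquiv_finiteDual`).

Conversely, an ideal of finite codimension in D[[x, α]] contains all series of large order, so the
finite dual is the union of the finite-dimensional duals of the truncations. A form in one truncated
dual but not in the preceding one generates the whole of it, so every coideal is comparable with
every other (`IsFiniteDual.truncDual_le_of_mem`). The smallest coideal has dimension dim D, which
separates all pairs except the two with D = ℂ; these differ by cocommutativity. -/

variable (k C) in
/-- The dual algebra `C*` of a coalgebra `C`, with the convolution product. -/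
abbrev DualAlgebra := WithConv (C →ₗ[k] k)

namespace DualAlgebra

/-- The left action of `C*` on `C`: `f ⬝ c = ∑ c₁ f(c₂)`. -/
def leftAct (f : DualAlgebra k C) : C →ₗ[k] C :=
  (TensorProduct.rid k C).toLinearMap ∘ₗ f.ofConv.lTensor C ∘ₗ Coalgebra.comul

/-- The right action of `C*` on `C`: `c ⬝ f = ∑ f(c₁) c₂`. -/
def rightAct (f : DualAlgebra k C) : C →ₗ[k] C :=
  (TensorProduct.lid k C).toLinearMap ∘ₗ f.ofConv.rTensor C ∘ₗ Coalgebra.comul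

/-- The left action is the transpose of right multiplication in C*. Together with its mirror image
and the separation of points by functionals, this reduces identities between the actions to
associativity of convolution. -/
lemma apply_leftAct (f g : DualAlgebra k C) (c : C) : f (leftAct g c) = (f * g) c := by
  simp only [leftAct, LinearMap.comp_apply, LinearMap.convMul_apply, LinearEquiv.coe_coe]
  induction Coalgebra.comul (R := k) c using TensorProduct.induction_on with
  | zero => simp
  | tmul a b => simp [mul_comm]
  | add x y hx hy => simp [hx, hy]

lemma apply_rightAct (f g : DualAlgebra k C) (c : C) : g (rightAct f c) = (f * g) c := by
  simp only [rightAct, LinearMap.comp_apply, LinearMap.convMul_apply, LinearEquiv.coe_coe]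
  induction Coalgebra.comul (R := k) c using TensorProduct.induction_on with
  | zero => simp
  | tmul a b => simp
  | add x y hx hy => simp [hx, hy]

omit [Coalgebra k C] in
lemma ext_of_forall_apply {c d : C} (h : ∀ f : DualAlgebra k C, f c = f d) : c = d := by
  rw [← sub_eq_zero, ← Module.forall_dual_apply_eq_zero_iff k]
  intro f
  rw [map_sub, sub_eq_zero]
  exact h (WithConv.toConv f)

/-- This makes every `rightAct g` an endomorphism of the comodule C, so that its kernel and its
images of coideals are coideals. -/
lemma leftAct_rightAct (f g : DualAlgebra k C) (c : C) :
    leftAct f (rightAct g c) = rightAct g (leftAct f c) :=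
  ext_of_forall_apply fun h => by
    rw [apply_leftAct, apply_rightAct, apply_rightAct, apply_leftAct, mul_assoc]

@[simp]
lemma leftAct_one (c : C) : leftAct (1 : DualAlgebra k C) c = c :=
  ext_of_forall_apply fun h => by rw [apply_leftAct, mul_one]

@[simp]
lemma rightAct_one (c : C) : rightAct (1 : DualAlgebra k C) c = c :=
  ext_of_forall_apply fun h => by rw [apply_rightAct, one_mul]

lemma leftAct_mul (f g : DualAlgebra k C) (c : C) : leftAct (f * g) c = leftAct f (leftAct g c) :=
  ext_of_forall_apply fun h => by rw [apply_leftAct, apply_leftAct, apply_leftAct, mul_assoc]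

lemma rightAct_mul (f g : DualAlgebra k C) (c : C) :
    rightAct (f * g) c = rightAct g (rightAct f c) :=
  ext_of_forall_apply fun h => by rw [apply_rightAct, apply_rightAct, apply_rightAct, mul_assoc]

lemma one_rightAct (f : DualAlgebra k C) (c : C) : (1 : DualAlgebra k C) (rightAct f c) = f c := by
  rw [apply_rightAct, mul_one]

lemma leftAct_eq_sum {c : C} {ι : Type*} (r : Coalgebra.Repr k c ι) (f : DualAlgebra k C) :
    leftAct f c = ∑ i ∈ r.index, f (r.right i) • r.left i := by
  simp [leftAct, ← r.eq]

lemma leftAct_add (f g : DualAlgebra k C) (c : C) :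
    leftAct (f + g) c = leftAct f c + leftAct g c :=
  ext_of_forall_apply (k := k) fun h => by
    rw [map_add, apply_leftAct, apply_leftAct, apply_leftAct, mul_add]
    rfl

lemma leftAct_smul (r : k) (f : DualAlgebra k C) (c : C) : leftAct (r • f) c = r • leftAct f c :=
  ext_of_forall_apply (k := k) fun h => by
    rw [map_smul, apply_leftAct, apply_leftAct, mul_smul_comm]
    rfl

end DualAlgebra

open DualAlgebra

/-! ### Right coideals -/

/-- For the converse direction, expand Δ(c) in a basis of the second tensor factor: its coefficients
are the vectors obtained from `c` by letting the coordinate functionals act. -/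
lemma isRightCoideal_iff (N : Submodule k C) :
    IsRightCoideal k N ↔ ∀ f : DualAlgebra k C, ∀ c ∈ N, leftAct f c ∈ N := by
  constructor
  · intro h f c hc
    obtain ⟨t, ht⟩ := h c hc
    simp only [leftAct, LinearMap.comp_apply, LinearEquiv.coe_coe, ← ht]
    clear ht
    induction t using TensorProduct.induction_on with
    | zero => simp
    | tmul a b => simpa using N.smul_mem _ a.2
    | add x y hx hy => simpa using N.add_mem hx hy
  · intro h c hc
    classical
    let b := Module.Basis.ofVectorSpace k C
    let e := TensorProduct.equivFinsuppOfBasisRight (M := C) b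
    have he : ∀ i, e (Coalgebra.comul (R := k) c) i =
        leftAct (WithConv.toConv (b.coord i)) c := by
      intro i
      simp only [leftAct, LinearMap.comp_apply, LinearEquiv.coe_coe]
      induction Coalgebra.comul (R := k) c using TensorProduct.induction_on with
      | zero => simp
      | tmul a d => simp [e]
      | add x y hx hy => simp [hx, hy]
    rw [← e.symm_apply_apply (Coalgebra.comul (R := k) c),
      TensorProduct.equivFinsuppOfBasisRight_symm_apply, Finsupp.sum]
    refine Submodule.sum_mem _ fun i _ => ⟨⟨_, ?_⟩ ⊗ₜ b i, rfl⟩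
    exact (he i).symm ▸ h _ _ hc

lemma IsRightCoideal.leftAct_mem {N : Submodule k C} (hN : IsRightCoideal k N)
    (f : DualAlgebra k C) {c : C} (hc : c ∈ N) : leftAct f c ∈ N :=
  (isRightCoideal_iff N).1 hN f c hc

lemma isRightCoideal_bot : IsRightCoideal k (⊥ : Submodule k C) :=
  (isRightCoideal_iff _).2 fun f c hc => by simp_all

lemma isRightCoideal_top : IsRightCoideal k (⊤ : Submodule k C) :=
  (isRightCoideal_iff _).2 fun _ _ _ => trivial

lemma IsRightCoideal.map_rightAct {N : Submodule k C} (hN : IsRightCoideal k N)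
    (g : DualAlgebra k C) : IsRightCoideal k (N.map (rightAct g)) := by
  rw [isRightCoideal_iff]
  rintro f _ ⟨c, hc, rfl⟩
  exact ⟨leftAct f c, hN.leftAct_mem f hc, (leftAct_rightAct f g c).symm⟩

lemma isRightCoideal_ker_rightAct (g : DualAlgebra k C) :
    IsRightCoideal k (LinearMap.ker (rightAct g)) := by
  rw [isRightCoideal_iff]
  intro f c hc
  rw [LinearMap.mem_ker] at hc ⊢
  rw [← leftAct_rightAct, hc, map_zero]

lemma IsRightCoideal.inf {M N : Submodule k C} (hM : IsRightCoideal k M)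
    (hN : IsRightCoideal k N) : IsRightCoideal k (M ⊓ N) :=
  (isRightCoideal_iff _).2 fun f _ hc => ⟨hM.leftAct_mem f hc.1, hN.leftAct_mem f hc.2⟩

/-- The finiteness theorem for comodules: each element generates a finite-dimensional coideal. -/
lemma exists_finiteDimensional_isRightCoideal (c : C) :
    ∃ N : Submodule k C, IsRightCoideal k N ∧ FiniteDimensional k N ∧ c ∈ N ∧
      ∀ M : Submodule k C, IsRightCoideal k M → c ∈ M → N ≤ M := by
  classical
  let r := Coalgebra.Repr.arbitrary k c
  -- The coideal is the orbit of `c` under C*; it lies in the span of the finitely many left legs of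
  -- Δ(c).
  let L : DualAlgebra k C →ₗ[k] C :=
    { toFun := fun f => leftAct f c
      map_add' := fun f g => leftAct_add f g c
      map_smul' := fun a f => leftAct_smul a f c }
  refine ⟨LinearMap.range L, ?_, ?_, ⟨1, leftAct_one c⟩, ?_⟩
  · rw [isRightCoideal_iff]
    rintro f _ ⟨g, rfl⟩
    exact ⟨f * g, leftAct_mul f g c⟩
  · have : LinearMap.range L ≤ Submodule.span k ((r.index.image r.left : Finset C) : Set C) := by
      rintro _ ⟨f, rfl⟩
      change leftAct f c ∈ _
      rw [leftAct_eq_sum r]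
      exact Submodule.sum_mem _ fun i hi => Submodule.smul_mem _ _
        (Submodule.subset_span (Finset.mem_image_of_mem _ hi))
    exact Submodule.finiteDimensional_of_le this
  · rintro M hM hc _ ⟨f, rfl⟩
    exact hM.leftAct_mem f hc

end Actions

/-! ### The structure of infinite-dimensional chain coalgebras -/

section Chain

open DualAlgebra

variable {k C : Type*} [Field k] [AddCommGroup C] [Module k C] [Coalgebra k C]

/-- In a chain coalgebra, finite-dimensional right coideals are subcoalgebras. -/
lemma IsChainCoalgebra.rightAct_mem (hC : IsChainCoalgebra k C) {N : Submodule k C}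
    (hN : IsRightCoideal k N) [FiniteDimensional k N] (f : DualAlgebra k C) {c : C} (hc : c ∈ N) :
    rightAct f c ∈ N := by
  -- The image is a coideal of dimension at most dim N. It is comparable with `N`, and it can
  -- contain `N` only by being equal to it.
  have hle : N.map (rightAct f) ≤ N := by
    rcases hC _ _ (hN.map_rightAct f) hN with h | h
    · exact h
    · exact (Submodule.eq_of_le_of_finrank_le h (Submodule.finrank_map_le _ _)).ge
  exact hle ⟨c, hc, rfl⟩

/-- Each element lies in a finite-dimensional coideal, which cannot contain `N` and hence is
contained in it. -/
lemma IsChainCoalgebra.eq_top_of_not_finiteDimensional (hC : IsChainCoalgebra k C)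
    {N : Submodule k C} (hN : IsRightCoideal k N) (h : ¬ FiniteDimensional k N) : N = ⊤ := by
  rw [eq_top_iff]
  rintro c -
  obtain ⟨M, hM, hfin, hc, -⟩ := exists_finiteDimensional_isRightCoideal (k := k) c
  rcases hC _ _ hM hN with h' | h'
  · exact h' hc
  · exact absurd (Submodule.finiteDimensional_of_le h') h

/-- `N` is the smallest right coideal that is not contained in `M`. -/
structure IsNextCoideal (M N : Submodule k C) : Prop where
  isRightCoideal : IsRightCoideal k N
  finiteDimensional : FiniteDimensional k N
  lt : M < N
  le_of_not_le : ∀ P : Submodule k C, IsRightCoideal k P → ¬ P ≤ M → N ≤ P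

/-- Take a coideal of least dimension among the finite-dimensional ones strictly above `M`. A
coideal not inside `M` contains the coideal generated by one of its elements outside `M`, which
competes in this minimum. -/
lemma IsChainCoalgebra.exists_isNextCoideal (hC : IsChainCoalgebra k C)
    (hinf : ¬ FiniteDimensional k C) {M : Submodule k C} (hM : IsRightCoideal k M)
    [FiniteDimensional k M] : ∃ N, IsNextCoideal M N := by
  have hne : ∃ c : C, c ∉ M := by
    by_contra! h
    have : M = ⊤ := by rw [eq_top_iff]; exact fun c _ => h c
    subst this
    exact hinf (Module.Finite.equiv Submodule.topEquiv)
  let s : Set (Submodule k C) := {N | IsRightCoideal k N ∧ FiniteDimensional k N ∧ M < N}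
  have hgen : ∀ c ∉ M, ∃ N ∈ s, ∀ P : Submodule k C, IsRightCoideal k P → c ∈ P → N ≤ P := by
    intro c hc
    obtain ⟨N, hN, hfin, hcN, hmin⟩ := exists_finiteDimensional_isRightCoideal (k := k) c
    refine ⟨N, ⟨hN, hfin, ?_⟩, hmin⟩
    rcases hC _ _ hM hN with h | h
    · exact lt_of_le_of_ne h fun h' => hc (h' ▸ hcN)
    · exact absurd (h hcN) hc
  obtain ⟨c, hc⟩ := hne
  obtain ⟨N₀, hN₀, -⟩ := hgen c hc
  obtain ⟨N, hN, hmin⟩ := exists_minimalFor_of_wellFoundedLT (· ∈ s)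
    (fun N : Submodule k C => Module.finrank k N) ⟨N₀, hN₀⟩
  have := hN.2.1
  refine ⟨N, hN.1, hN.2.1, hN.2.2, fun P hP hPM => ?_⟩
  obtain ⟨d, hdP, hdM⟩ := SetLike.not_le_iff_exists.1 hPM
  obtain ⟨Q, hQ, hQmin⟩ := hgen d hdM
  refine le_trans ?_ (hQmin P hP hdP)
  rcases hC _ _ hN.1 hQ.1 with h | h
  · exact h
  · have h2 : Module.finrank k N ≤ Module.finrank k Q := hmin hQ (Submodule.finrank_mono h)
    exact (Submodule.eq_of_le_of_finrank_le h h2).ge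

/-- `S` is the smallest nonzero right coideal. -/
abbrev IsSmallestCoideal (S : Submodule k C) : Prop := IsNextCoideal ⊥ S

/-! ### Functionals vanishing on the smallest coideal -/

variable {S : Submodule k C}

lemma IsSmallestCoideal.le (hS : IsSmallestCoideal S) {N : Submodule k C}
    (hN : IsRightCoideal k N) (h : N ≠ ⊥) : S ≤ N :=
  hS.le_of_not_le N hN (by rwa [le_bot_iff])

/-- The functionals that vanish on a right coideal form a right ideal. -/
lemma IsRightCoideal.mul_apply_eq_zero {N : Submodule k C} (hN : IsRightCoideal k N)
    {f : DualAlgebra k C} (hf : ∀ c ∈ N, f c = 0) (g : DualAlgebra k C) :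
    ∀ c ∈ N, (f * g) c = 0 := fun c hc => by
  rw [← apply_leftAct]
  exact hf _ (hN.leftAct_mem g hc)

/-- The functionals that vanish on a finite-dimensional right coideal of a chain coalgebra form a
left ideal. -/
lemma IsChainCoalgebra.mul_apply_eq_zero (hC : IsChainCoalgebra k C) {N : Submodule k C}
    (hN : IsRightCoideal k N) [FiniteDimensional k N] {f : DualAlgebra k C}
    (hf : ∀ c ∈ N, f c = 0) (g : DualAlgebra k C) : ∀ c ∈ N, (g * f) c = 0 := fun c hc => by
  rw [← apply_rightAct]
  exact hf _ (hC.rightAct_mem hN g hc)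

lemma IsRightCoideal.rightAct_eq_zero {N : Submodule k C} (hN : IsRightCoideal k N)
    {f : DualAlgebra k C} (hf : ∀ c ∈ N, f c = 0) {c : C} (hc : c ∈ N) : rightAct f c = 0 :=
  ext_of_forall_apply fun g => by
    rw [apply_rightAct, map_zero]
    exact hN.mul_apply_eq_zero hf g c hc

/-- Functionals that do not vanish on the smallest coideal `S` are invertible modulo those that
vanish on `S`. -/
lemma IsSmallestCoideal.exists_mul_eq_one (hC : IsChainCoalgebra k C) (hS : IsSmallestCoideal S)
    {f : DualAlgebra k C} {s : C} (hs : s ∈ S) (hf : f s ≠ 0) :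
    ∃ g : DualAlgebra k C, ∀ c ∈ S, (f * g) c = (1 : DualAlgebra k C) c := by
  have := hS.finiteDimensional
  let ρ : S →ₗ[k] S := (rightAct f).restrict
    fun c hc => hC.rightAct_mem hS.isRightCoideal f hc
  have hinj : Function.Injective ρ := by
    rw [injective_iff_map_eq_zero]
    intro c hc
    have hc' : rightAct f (c : C) = 0 := congrArg Subtype.val hc
    by_contra hne
    -- A nonzero kernel on `S` would be all of `S` by minimality, so the counit would give `f s =
    -- 0`.
    have hle := hS.le (hS.isRightCoideal.inf (isRightCoideal_ker_rightAct f))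
      (fun h => hne (Subtype.ext ((Submodule.mem_bot k).1 (h ▸ ⟨c.2, hc'⟩))))
    apply hf
    rw [← one_rightAct, LinearMap.mem_ker.1 (hle hs).2, map_zero]
  let e : S ≃ₗ[k] S := LinearEquiv.ofInjectiveEndo ρ hinj
  -- On `S`, `g` has to be the counit composed with the inverse of the right action of `f`; outside
  -- `S` any extension will do.
  obtain ⟨g, hg⟩ := LinearMap.exists_extend
    ((1 : DualAlgebra k C).ofConv ∘ₗ S.subtype ∘ₗ e.symm.toLinearMap)
  refine ⟨WithConv.toConv g, fun c hc => ?_⟩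
  rw [← apply_rightAct]
  have h1 := LinearMap.congr_fun hg (ρ ⟨c, hc⟩)
  have h2 : e.symm (ρ ⟨c, hc⟩) = ⟨c, hc⟩ := e.symm_apply_apply _
  simp only [LinearMap.comp_apply, LinearEquiv.coe_coe, h2] at h1
  exact h1

/-- `t` is topologically nilpotent in `C*`. -/
def DualAlgebra.IsLocallyNilpotent (t : DualAlgebra k C) : Prop :=
  ∀ c : C, ∃ n, ∀ m ≥ n, ∀ f : DualAlgebra k C, (f * t ^ m) c = 0 ∧ (t ^ m * f) c = 0

/-- Functionals that vanish on the smallest coideal are topologically nilpotent. -/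
lemma IsSmallestCoideal.isLocallyNilpotent (hC : IsChainCoalgebra k C)
    (hS : IsSmallestCoideal S) {t : DualAlgebra k C} (ht : ∀ c ∈ S, t c = 0) :
    t.IsLocallyNilpotent := by
  -- Induction on dim N. The right action of `t` maps `N` into itself and kills S ⊆ N, so it is not
  -- surjective on `N`: each factor `t` lowers the dimension.
  have key : ∀ n (N : Submodule k C), IsRightCoideal k N → FiniteDimensional k N →
      Module.finrank k N ≤ n → ∀ m ≥ n, ∀ c ∈ N, (t ^ m) c = 0 := by
    intro n
    induction n with
    | zero =>
      intro N hN _ hdim m _ c hc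
      rw [Nat.le_zero, Submodule.finrank_eq_zero] at hdim
      subst hdim
      rw [(Submodule.mem_bot k).1 hc, map_zero]
    | succ n ih =>
      intro N hN _ hdim m hm c hc
      by_cases hN0 : N = ⊥
      · subst hN0
        rw [(Submodule.mem_bot k).1 hc, map_zero]
      obtain ⟨m, rfl⟩ : ∃ m', m = m' + 1 := ⟨m - 1, by lia⟩
      rw [pow_succ', ← apply_rightAct]
      refine ih (N.map (rightAct t)) (hN.map_rightAct t) inferInstance ?_ m (by lia) _ ⟨c, hc, rfl⟩
      have hlt : N.map (rightAct t) < N := by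
        refine lt_of_le_of_ne ?_ fun heq => ?_
        · rintro _ ⟨d, hd, rfl⟩
          exact hC.rightAct_mem hN t hd
        · obtain ⟨s, hs, hs0⟩ := Submodule.exists_mem_ne_zero_of_ne_bot hS.lt.ne'
          let ρ : N →ₗ[k] N := (rightAct t).restrict fun c hc => hC.rightAct_mem hN t hc
          have hsurj : Function.Surjective ρ := by
            rintro ⟨d, hd⟩
            rw [← heq] at hd
            obtain ⟨d', hd', rfl⟩ := hd
            exact ⟨⟨d', hd'⟩, rfl⟩
          have hinj := LinearMap.injective_iff_surjective.2 hsurj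
          have : ρ ⟨s, hS.le hN hN0 hs⟩ = 0 :=
            Subtype.ext (hS.isRightCoideal.rightAct_eq_zero ht hs)
          rw [map_eq_zero_iff _ hinj] at this
          exact hs0 (congrArg Subtype.val this)
      have := Submodule.finrank_lt_finrank_of_lt hlt
      lia
  intro c
  obtain ⟨N, hN, hfin, hc, -⟩ := exists_finiteDimensional_isRightCoideal (k := k) c
  refine ⟨Module.finrank k N, fun m hm f => ⟨?_, ?_⟩⟩
  · rw [← apply_rightAct]
    exact key _ N hN hfin le_rfl m hm _ (hC.rightAct_mem hN f hc)
  · rw [← apply_leftAct]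
    exact key _ N hN hfin le_rfl m hm _ (hN.leftAct_mem f hc)

/-- If `x` vanishes on the smallest coideal, but not on the next one, then the kernel of its right
action is the smallest coideal. -/
lemma IsNextCoideal.mem_of_rightAct_eq_zero {T : Submodule k C} (hT : IsNextCoideal S T)
    {x : DualAlgebra k C} {d : C} (hd : d ∈ T) (hxd : x d ≠ 0) {c : C}
    (hc : rightAct x c = 0) : c ∈ S := by
  by_contra hcS
  have hle := hT.le_of_not_le _ (isRightCoideal_ker_rightAct x) (fun h => hcS (h hc))
  apply hxd
  rw [← one_rightAct, LinearMap.mem_ker.1 (hle hd), map_zero]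

end Chain

/-! ### Evaluation of skew power series in the dual algebra -/

section Evaluation

open DualAlgebra Filter

variable {k C D : Type*} [Field k] [AddCommGroup C] [Module k C] [Coalgebra k C]
  [Ring D] [Algebra k D] {α : D ≃ₐ[k] D}

namespace DualAlgebra

/-- The partial sums of the series `∑ ι(bₘ) tᵐ` in `C*`. -/
def partialEval (ι : D →ₐ[k] DualAlgebra k C) (t : DualAlgebra k C) (b : ℕ → D) (n : ℕ) :
    DualAlgebra k C :=
  ∑ m ∈ Finset.range n, ι (b m) * t ^ m

omit [Coalgebra k C] in
lemma sum_apply {σ : Type*} (s : Finset σ) (f : σ → DualAlgebra k C) (c : C) :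
    (∑ i ∈ s, f i) c = ∑ i ∈ s, f i c :=
  map_sum (⟨⟨fun f : DualAlgebra k C => f c, rfl⟩, fun _ _ => rfl⟩ : DualAlgebra k C →+ k) f s

lemma partialEval_apply (ι : D →ₐ[k] DualAlgebra k C) (t : DualAlgebra k C) (b : ℕ → D) (n : ℕ)
    (c : C) : partialEval ι t b n c = ∑ m ∈ Finset.range n, (ι (b m) * t ^ m) c :=
  sum_apply _ _ _

/-- The index depends on `c` only, not on the coefficients `b`. -/
lemma IsLocallyNilpotent.exists_forall_partialEval_eq {t : DualAlgebra k C}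
    (ht : t.IsLocallyNilpotent) (ι : D →ₐ[k] DualAlgebra k C) (c : C) :
    ∃ n, ∀ m ≥ n, ∀ b : ℕ → D, partialEval ι t b m c = partialEval ι t b n c := by
  obtain ⟨n, hn⟩ := ht c
  refine ⟨n, fun m hm b => ?_⟩
  rw [partialEval_apply, partialEval_apply]
  refine (Finset.sum_subset (Finset.range_mono hm) fun i _ hi => (hn i ?_ _).1).symm
  simpa using hi

/-- The sum of the series `∑ ι(bₘ) tᵐ` in `C*`, for topologically nilpotent `t`. -/
def eval (ι : D →ₐ[k] DualAlgebra k C) {t : DualAlgebra k C} (ht : t.IsLocallyNilpotent)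
    (b : ℕ → D) : DualAlgebra k C :=
  WithConv.toConv
    { toFun := fun c => partialEval ι t b (ht.exists_forall_partialEval_eq ι c).choose c
      map_add' := fun c d => by
        have h1 := (ht.exists_forall_partialEval_eq ι c).choose_spec
        have h2 := (ht.exists_forall_partialEval_eq ι d).choose_spec
        have h3 := (ht.exists_forall_partialEval_eq ι (c + d)).choose_spec
        set n1 := (ht.exists_forall_partialEval_eq ι c).choose
        set n2 := (ht.exists_forall_partialEval_eq ι d).choose
        set n3 := (ht.exists_forall_partialEval_eq ι (c + d)).choose
        rw [← h1 (n1 + n2 + n3) (by lia), ← h2 (n1 + n2 + n3) (by lia),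
          ← h3 (n1 + n2 + n3) (by lia), map_add]
      map_smul' := fun a c => by
        have h1 := (ht.exists_forall_partialEval_eq ι c).choose_spec
        have h3 := (ht.exists_forall_partialEval_eq ι (a • c)).choose_spec
        set n1 := (ht.exists_forall_partialEval_eq ι c).choose
        set n3 := (ht.exists_forall_partialEval_eq ι (a • c)).choose
        rw [← h1 (n1 + n3) (by lia), ← h3 (n1 + n3) (by lia), map_smul, RingHom.id_apply] }

variable (ι : D →ₐ[k] DualAlgebra k C) {t : DualAlgebra k C} (ht : t.IsLocallyNilpotent)

lemma eventually_eval_apply (b : ℕ → D) (c : C) :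
    ∀ᶠ n in atTop, eval ι ht b c = partialEval ι t b n c := by
  filter_upwards [eventually_ge_atTop (ht.exists_forall_partialEval_eq ι c).choose] with n hn
  exact ((ht.exists_forall_partialEval_eq ι c).choose_spec n hn b).symm

/-- Δ(c) has finitely many right legs, so one truncation is exact on all of them and hence serves
all `f` at once. -/
lemma eventually_mul_eval_apply (b : ℕ → D) (c : C) :
    ∀ᶠ n in atTop, ∀ f : DualAlgebra k C, (f * eval ι ht b) c = (f * partialEval ι t b n) c := by
  let r := Coalgebra.Repr.arbitrary k c
  have h : ∀ᶠ n in atTop, ∀ i ∈ r.index, eval ι ht b (r.right i) =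
      partialEval ι t b n (r.right i) :=
    (Finset.eventually_all _).2 fun i _ => eventually_eval_apply ι ht b _
  filter_upwards [h] with n hn f
  rw [r.convMul_apply, r.convMul_apply]
  exact Finset.sum_congr rfl fun i hi => by rw [hn i hi]

lemma eventually_eval_mul_apply (b : ℕ → D) (c : C) :
    ∀ᶠ n in atTop, ∀ f : DualAlgebra k C, (eval ι ht b * f) c = (partialEval ι t b n * f) c := by
  let r := Coalgebra.Repr.arbitrary k c
  have h : ∀ᶠ n in atTop, ∀ i ∈ r.index, eval ι ht b (r.left i) =
      partialEval ι t b n (r.left i) :=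
    (Finset.eventually_all _).2 fun i _ => eventually_eval_apply ι ht b _
  filter_upwards [h] with n hn f
  rw [r.convMul_apply, r.convMul_apply]
  exact Finset.sum_congr rfl fun i hi => by rw [hn i hi]

lemma eval_single (w : D) (m : ℕ) :
    eval ι ht (Pi.single m w) = ι w * t ^ m := by
  ext c
  obtain ⟨n, hn, hnm⟩ := ((eventually_eval_apply ι ht (Pi.single m w) c).and
    (eventually_gt_atTop m)).exists
  rw [hn, partialEval_apply, Finset.sum_eq_single m]
  · simp only [Pi.single_eq_same]
  · intro i _ hi
    simp only [Pi.single_eq_of_ne hi, map_zero, zero_mul]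
    rfl
  · intro h
    simp at h
    lia

lemma commute_eval {f : DualAlgebra k C} (hft : Commute f t) {b : ℕ → D}
    (hfb : ∀ m, Commute f (ι (b m))) : Commute f (eval ι ht b) := by
  have h : ∀ n, Commute f (partialEval ι t b n) := fun n =>
    Commute.sum_right _ _ _ fun m _ => (hfb m).mul_right (hft.pow_right m)
  ext c
  obtain ⟨n, h1, h2⟩ := ((eventually_mul_eval_apply ι ht b c).and
    (eventually_eval_mul_apply ι ht b c)).exists
  rw [h1, h2, (h n).eq]

lemma pow_mul_eq_map_mul_pow {x : DualAlgebra k C} (hx : ∀ w, x * ι w = ι (α w) * x) (n : ℕ)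
    (w : D) : x ^ n * ι w = ι ((α ^ n) w) * x ^ n := by
  induction n generalizing w with
  | zero => simp
  | succ n ih =>
    rw [pow_succ, mul_assoc, hx, ← mul_assoc, ih, mul_assoc, pow_succ α]
    rfl

/-- Evaluation of skew power series at a topologically nilpotent element `x` of `C*` with
`x ι(w) = ι(α(w)) x`. -/
def evalHom {x : DualAlgebra k C} (hx : x.IsLocallyNilpotent)
    (hxι : ∀ w, x * ι w = ι (α w) * x) : SkewPowerSeries α →ₐ[k] DualAlgebra k C :=
  AlgHom.ofLinearMap
    { toFun := fun b => eval ι hx b.coeff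
      map_add' := fun a b => by
        ext c
        obtain ⟨n, h1, h2, h3⟩ := ((eventually_eval_apply ι hx (a + b).coeff c).and
          ((eventually_eval_apply ι hx a.coeff c).and
            (eventually_eval_apply ι hx b.coeff c))).exists
        change _ = eval ι hx a.coeff c + eval ι hx b.coeff c
        rw [h1, h2, h3, partialEval_apply, partialEval_apply, partialEval_apply,
          ← Finset.sum_add_distrib]
        refine Finset.sum_congr rfl fun i _ => ?_
        rw [SkewPowerSeries.coeff_add, map_add, add_mul]
        rfl
      map_smul' := fun r b => by
        ext c
        obtain ⟨n, h1, h2⟩ := ((eventually_eval_apply ι hx (r • b).coeff c).and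
          (eventually_eval_apply ι hx b.coeff c)).exists
        change _ = r • eval ι hx b.coeff c
        rw [h1, h2, partialEval_apply, partialEval_apply, Finset.smul_sum]
        refine Finset.sum_congr rfl fun i _ => ?_
        rw [SkewPowerSeries.coeff_smul, map_smul, smul_mul_assoc]
        rfl }
    (by
      have : (1 : SkewPowerSeries α).coeff = Pi.single 0 1 := by
        ext n
        simp [SkewPowerSeries.coeff_one, Pi.single_apply]
      change eval ι hx (1 : SkewPowerSeries α).coeff = 1
      rw [this, eval_single]
      simp)
    (fun a b => by
      change eval ι hx (a * b).coeff = eval ι hx a.coeff * eval ι hx b.coeff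
      ext c
      obtain ⟨N, hN⟩ := hx c
      obtain ⟨n, h1, h2, h3, hn⟩ := ((eventually_eval_apply ι hx (a * b).coeff c).and
        ((eventually_mul_eval_apply ι hx b.coeff c).and
          ((eventually_eval_mul_apply ι hx a.coeff c).and (eventually_ge_atTop N)))).exists
      have hterm : ∀ i j, ι (a.coeff i) * x ^ i * (ι (b.coeff j) * x ^ j) =
          ι (a.coeff i * (α ^ i) (b.coeff j)) * x ^ (i + j) := fun i j => by
        rw [mul_assoc, ← mul_assoc (x ^ i), pow_mul_eq_map_mul_pow ι hxι, map_mul, pow_add]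
        simp only [mul_assoc]
      -- The product of the partial sums runs over the square i, j < n, the partial sum of the
      -- product over the triangle i + j < n. The remaining terms contain a power of `x` that
      -- already vanishes at `c`.
      let F : ℕ × ℕ → k := fun p => (ι (a.coeff p.1 * (α ^ p.1) (b.coeff p.2)) * x ^ (p.1 + p.2)) c
      have hF : ∀ p : ℕ × ℕ, n ≤ p.1 + p.2 → F p = 0 := fun p hp => (hN _ (by lia) _).1
      have hl : (partialEval ι x a.coeff n * partialEval ι x b.coeff n) c =
          ∑ p ∈ Finset.range n ×ˢ Finset.range n, F p := by
        rw [partialEval, partialEval, Finset.sum_mul_sum, ← Finset.sum_product', sum_apply]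
        exact Finset.sum_congr rfl fun p _ => by rw [hterm]
      have hr : partialEval ι x (a * b).coeff n c =
          ∑ m ∈ Finset.range n, ∑ p ∈ Finset.HasAntidiagonal.antidiagonal m, F p := by
        rw [partialEval_apply]
        refine Finset.sum_congr rfl fun m _ => ?_
        rw [SkewPowerSeries.coeff_mul, map_sum, Finset.sum_mul, sum_apply]
        refine Finset.sum_congr rfl fun p hp => ?_
        rw [← Finset.HasAntidiagonal.mem_antidiagonal.1 hp]
      rw [h1, h2, h3, hl, hr, Finset.sum_sigma']
      refine Finset.sum_of_injOn (fun q => q.2) ?_ ?_ ?_ fun _ _ => rfl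
      · rintro ⟨m, p⟩ h ⟨m', p'⟩ h' (rfl : p = p')
        simp only [Finset.coe_sigma, Set.mem_sigma_iff, Finset.mem_coe,
          Finset.HasAntidiagonal.mem_antidiagonal] at h h'
        obtain rfl : m = m' := h.2.symm.trans h'.2
        rfl
      · rintro ⟨m, p⟩ h
        simp only [Finset.coe_sigma, Set.mem_sigma_iff, Finset.mem_coe, Finset.mem_range,
          Finset.HasAntidiagonal.mem_antidiagonal] at h
        simp only [Finset.coe_product, Set.mem_prod, Finset.mem_coe, Finset.mem_range]
        lia
      · intro p _ hp
        refine hF p (le_of_not_gt fun hlt => hp ⟨⟨p.1 + p.2, p⟩, ?_, rfl⟩)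
        simp [hlt])

lemma evalHom_single {x : DualAlgebra k C} (hx : x.IsLocallyNilpotent)
    (hxι : ∀ w, x * ι w = ι (α w) * x) (w : D) (m : ℕ) :
    evalHom ι hx hxι ⟨Pi.single m w⟩ = ι w * x ^ m :=
  eval_single ι hx w m

/-- An element `c` sees only finitely many coefficients; this is what puts the form b ↦ b(x)(c) into
the finite dual. -/
lemma exists_evalHom_apply_eq_zero {x : DualAlgebra k C} (hx : x.IsLocallyNilpotent)
    (hxι : ∀ w, x * ι w = ι (α w) * x) (c : C) :
    ∃ n, ∀ b : SkewPowerSeries α, (∀ m < n, b.coeff m = 0) → evalHom ι hx hxι b c = 0 := by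
  obtain ⟨n, hn⟩ := hx c
  refine ⟨n, fun b hb => ?_⟩
  obtain ⟨m, hm⟩ := (eventually_eval_apply ι hx b.coeff c).exists
  change eval ι hx b.coeff c = 0
  rw [hm, partialEval_apply]
  refine Finset.sum_eq_zero fun i _ => ?_
  rcases lt_or_ge i n with h | h
  · rw [hb i h, map_zero, zero_mul]
    rfl
  · exact (hn i h _).1

end DualAlgebra

end Evaluation

/-! ### The ideals of series of order at least `n` -/

namespace SkewPowerSeries

variable {k D : Type*} [Field k] [Ring D] [Algebra k D] (α : D ≃ₐ[k] D)

/-- The two-sided ideal of all skew power series of order at least `n`. -/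
def orderIdeal (n : ℕ) : Ideal (SkewPowerSeries α) where
  carrier := {b | ∀ m < n, b.coeff m = 0}
  zero_mem' _ _ := rfl
  add_mem' ha hb m hm := by rw [coeff_add, ha m hm, hb m hm, add_zero]
  smul_mem' a b hb m hm := by
    rw [smul_eq_mul, coeff_mul]
    refine Finset.sum_eq_zero fun p hp => ?_
    rw [Finset.HasAntidiagonal.mem_antidiagonal] at hp
    rw [hb p.2 (by lia), map_zero, mul_zero]

variable {α}

lemma mem_orderIdeal {n : ℕ} {b : SkewPowerSeries α} :
    b ∈ orderIdeal α n ↔ ∀ m < n, b.coeff m = 0 := Iff.rfl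

instance (n : ℕ) : (orderIdeal α n).IsTwoSided :=
  ⟨fun a hb m hm => by
    rw [coeff_mul]
    refine Finset.sum_eq_zero fun p hp => ?_
    rw [Finset.HasAntidiagonal.mem_antidiagonal] at hp
    rw [hb p.1 (by lia), zero_mul]⟩

lemma orderIdeal_anti {m n : ℕ} (h : m ≤ n) : orderIdeal α n ≤ orderIdeal α m :=
  fun _ hb i hi => hb i (by lia)

instance [FiniteDimensional k D] (n : ℕ) :
    FiniteDimensional k (SkewPowerSeries α ⧸ orderIdeal α n) := by
  let φ : SkewPowerSeries α →ₗ[k] Fin n → D :=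
    { toFun := fun b i => b.coeff i
      map_add' := fun _ _ => rfl
      map_smul' := fun _ _ => rfl }
  have hφ : LinearMap.ker φ = (orderIdeal α n).restrictScalars k := by
    ext b
    simp only [LinearMap.mem_ker, Submodule.restrictScalars_mem, mem_orderIdeal]
    exact ⟨fun h m hm => congrFun h ⟨m, hm⟩, fun h => funext fun i => h i i.2⟩
  have h1 : Module.Finite k (SkewPowerSeries α ⧸ LinearMap.ker φ) :=
    Module.Finite.equiv φ.quotKerEquivRange.symm
  rw [hφ] at h1
  exact Module.Finite.equiv (Submodule.Quotient.restrictScalarsEquiv k (orderIdeal α n))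

end SkewPowerSeries

/-! ### Coalgebra maps into finite duals -/

section ToFiniteDual

open DualAlgebra

variable {k C A : Type*} [Field k] [AddCommGroup C] [Module k C] [Coalgebra k C]
  [Ring A] [Algebra k A]

/-- An algebra map `φ : A → C*` such that all `a ↦ φ(a)(c)` are in `A°` yields a coalgebra map
`C → A°`. -/
def coalgHomToFiniteDual (φ : A →ₐ[k] DualAlgebra k C)
    (hφ : ∀ c : C, ∃ I : Ideal A, I.IsTwoSided ∧ Module.Finite k (A ⧸ I) ∧
      ∀ a ∈ I, φ a c = 0) : C →ₗc[k] finiteDual k A :=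
  let ψ : C →ₗ[k] finiteDual k A :=
    { toFun := fun c => ⟨
        { toFun := fun a => φ a c
          map_add' := fun a b => by rw [map_add]; rfl
          map_smul' := fun r a => by rw [map_smul]; rfl }, hφ c⟩
      map_add' := fun c d => by
        refine Subtype.ext (LinearMap.ext fun a => ?_)
        exact map_add (φ a).ofConv c d
      map_smul' := fun r c => by
        refine Subtype.ext (LinearMap.ext fun a => ?_)
        exact map_smul (φ a).ofConv r c }
  { ψ with
    counit_comp := by
      refine LinearMap.ext fun c => ?_
      change φ 1 c = _
      rw [map_one]
      rfl
    map_comp_comul := by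
      refine LinearMap.ext fun c => finiteDual.pairing_injective k A ?_
      ext ⟨a, b⟩
      have h1 : ∀ u : C ⊗[k] C, finiteDual.pairing k A (TensorProduct.map ψ ψ u) (a, b) =
          LinearMap.mul' k k (TensorProduct.map (φ a).ofConv (φ b).ofConv u) := by
        intro u
        induction u using TensorProduct.induction_on with
        | zero => simp
        | tmul x y => rfl
        | add x y hx hy => simp [hx, hy]
      refine (h1 _).trans ?_
      refine Eq.trans ?_ (finiteDual.pairing_comul k A (ψ c) (a, b)).symm
      change (φ a * φ b) c = φ (a * b) c
      rw [map_mul] }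

variable {C' : Type*} [AddCommGroup C'] [Module k C'] [Coalgebra k C']

/-- A coalgebra map is linear over C'* acting on C by pullback, so it maps coideals to coideals. -/
lemma leftAct_coalgHom (F : C →ₗc[k] C') (f : DualAlgebra k C') (c : C) :
    leftAct f (F c) = F (leftAct (WithConv.toConv (f.ofConv ∘ₗ F.toLinearMap)) c) := by
  have h := LinearMap.congr_fun F.map_comp_comul c
  simp only [LinearMap.comp_apply] at h
  simp only [leftAct, LinearMap.comp_apply, LinearEquiv.coe_coe]
  change (TensorProduct.rid k C') ((f.ofConv.lTensor C')
    (CoalgebraStruct.comul (F.toLinearMap c))) = _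
  rw [← h]
  induction CoalgebraStruct.comul (R := k) c using TensorProduct.induction_on with
  | zero => simp
  | tmul a b => simp
  | add x y hx hy => simp only [map_add, hx, hy]

lemma IsRightCoideal.map_coalgHom {N : Submodule k C} (hN : IsRightCoideal k N)
    (F : C →ₗc[k] C') : IsRightCoideal k (N.map F.toLinearMap) := by
  rw [isRightCoideal_iff]
  rintro f _ ⟨c, hc, rfl⟩
  exact ⟨_, hN.leftAct_mem _ hc, (leftAct_coalgHom F f c).symm⟩

/-- An injective coalgebra map from an infinite-dimensional coalgebra to a chain coalgebra is
bijective. -/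
lemma IsChainCoalgebra.bijective_of_injective (hC' : IsChainCoalgebra k C')
    (hinf : ¬ FiniteDimensional k C) (F : C →ₗc[k] C') (hF : Function.Injective F) :
    Function.Bijective F := by
  refine ⟨hF, ?_⟩
  have h := hC'.eq_top_of_not_finiteDimensional
    ((isRightCoideal_top (k := k) (C := C)).map_coalgHom F) fun hfin => hinf ?_
  · intro d
    obtain ⟨c, -, hc⟩ := h.ge (Submodule.mem_top (x := d))
    exact ⟨c, hc⟩
  · have e := (Submodule.equivMapOfInjective F.toLinearMap hF (⊤ : Submodule k C))
    exact Module.Finite.equiv (e.symm.trans Submodule.topEquiv)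

end ToFiniteDual

lemma PowerSeries.not_finiteDimensional (k : Type*) [Field k] :
    ¬ FiniteDimensional k (PowerSeries k) := by
  intro h
  have : FiniteDimensional k (Polynomial k) :=
    Module.Finite.of_injective (Polynomial.coeToPowerSeries.algHom (R := k) k).toLinearMap (by
      intro p q hpq
      simpa using hpq)
  exact Polynomial.not_finite this

lemma finite_quotient_comap {k A B : Type*} [Field k] [Ring A] [Algebra k A] [Ring B]
    [Algebra k B] (e : A →ₐ[k] B) (I : Ideal B) [Module.Finite k (B ⧸ I)] :
    Module.Finite k (A ⧸ I.comap e) := by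
  let ψ : A →ₗ[k] B ⧸ I := (Submodule.mkQ I).restrictScalars k ∘ₗ e.toLinearMap
  have hψ : LinearMap.ker ψ = (I.comap e).restrictScalars k := by
    ext a
    exact Submodule.Quotient.mk_eq_zero I
  have h1 : Module.Finite k (A ⧸ LinearMap.ker ψ) :=
    Module.Finite.equiv ψ.quotKerEquivRange.symm
  rw [hψ] at h1
  exact Module.Finite.equiv (Submodule.Quotient.restrictScalarsEquiv k (I.comap e))

/-! ### Evaluation on finite duals -/

namespace finiteDual

open DualAlgebra

section

variable {k A : Type*} [Field k] [Ring A] [Algebra k A]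

/-- Evaluation at `a`, as a functional on `A°`. -/
def evalAt : A →ₗ[k] DualAlgebra k (finiteDual k A) where
  toFun a := WithConv.toConv
    { toFun := fun f => f.1 a
      map_add' := fun _ _ => rfl
      map_smul' := fun _ _ => rfl }
  map_add' a b := by
    ext f
    exact map_add f.1 a b
  map_smul' r a := by
    ext f
    exact map_smul f.1 r a

lemma evalAt_mul (a b : A) : evalAt (k := k) (a * b) = evalAt a * evalAt b := by
  ext f
  refine (finiteDual.pairing_comul k A f (a, b)).symm.trans ?_
  have h : ∀ u : finiteDual k A ⊗[k] finiteDual k A, finiteDual.pairing k A u (a, b) =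
      LinearMap.mul' k k (TensorProduct.map (evalAt a).ofConv (evalAt b).ofConv u) := by
    intro u
    induction u using TensorProduct.induction_on with
    | zero => simp
    | tmul x y => rfl
    | add x y hx hy => simp only [map_add, Pi.add_apply, hx, hy]
  exact h _

variable (k A) in
/-- The canonical algebra map `A → (A°)*`. -/
def evalHom : A →ₐ[k] DualAlgebra k (finiteDual k A) :=
  AlgHom.ofLinearMap evalAt rfl evalAt_mul

lemma pairing_comm (u : finiteDual k A ⊗[k] finiteDual k A) (a b : A) :
    pairing k A (TensorProduct.comm k _ _ u) (a, b) = pairing k A u (b, a) := by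
  induction u using TensorProduct.induction_on with
  | zero => simp
  | tmul x y => exact mul_comm _ _
  | add x y hx hy => simp only [map_add, Pi.add_apply, hx, hy]

/-- If `A` is commutative and `A° ≅ B°`, then `B` is commutative as far as `B°` can tell. -/
lemma apply_mul_comm_of_coalgEquiv {B : Type*} [Ring B] [Algebra k B]
    (hcomm : ∀ a b : A, a * b = b * a) (e : finiteDual k A ≃ₗc[k] finiteDual k B)
    (f : finiteDual k B) (a b : B) : f.1 (a * b) = f.1 (b * a) := by
  -- Commutativity of `A` is cocommutativity of its finite dual, and the latter is transported along
  -- `e`.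
  have h1 : ∀ u : finiteDual k A, TensorProduct.comm k _ _
      (Coalgebra.comul (R := k) u) = Coalgebra.comul (R := k) u := by
    intro u
    refine finiteDual.pairing_injective k _ ?_
    ext ⟨x, y⟩
    rw [finiteDual.pairing_comm]
    refine (finiteDual.pairing_comul k _ u (y, x)).trans ?_
    refine Eq.trans ?_ (finiteDual.pairing_comul k _ u (x, y)).symm
    rw [hcomm]
  rw [← finiteDual.pairing_comul k _ f (a, b), ← finiteDual.pairing_comul k _ f (b, a)]
  obtain ⟨u, rfl⟩ := e.surjective f
  have h2 : Coalgebra.comul (R := k) (e u) =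
      TensorProduct.map e.toLinearEquiv.toLinearMap e.toLinearEquiv.toLinearMap
        (Coalgebra.comul (R := k) u) :=
    (LinearMap.congr_fun e.map_comp_comul u).symm
  change finiteDual.pairing k _ (Coalgebra.comul (R := k) (e u)) (a, b) =
    finiteDual.pairing k _ (Coalgebra.comul (R := k) (e u)) (b, a)
  rw [← finiteDual.pairing_comm, h2]
  conv_lhs => rw [← h1]
  rw [← TensorProduct.map_comm, TensorProduct.comm_comm]

end

end finiteDual

/-! ### The finite dual of a skew power series ring -/

namespace SkewPowerSeries

variable {k D : Type*} [Field k] [Ring D] [Algebra k D] {α : D ≃ₐ[k] D}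

variable (α) in
/-- The inclusion of the power series with coefficients in the ground field. -/
def ofPowerSeries : PowerSeries k →ₐ[k] SkewPowerSeries α :=
  AlgHom.ofLinearMap
    { toFun := fun p => ⟨fun n => algebraMap k D (PowerSeries.coeff n p)⟩
      map_add' := fun p q => by ext n; simp
      map_smul' := fun r p => by ext n; simp [coeff_smul, Algebra.smul_def (A := D)] }
    (by
      ext n
      rcases eq_or_ne n 0 with h | h <;> simp [PowerSeries.coeff_one, coeff_one, h])
    (fun p q => by ext n; simp [PowerSeries.coeff_mul, coeff_mul])

lemma coeff_ofPowerSeries (p : PowerSeries k) (n : ℕ) :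
    (ofPowerSeries α p).coeff n = algebraMap k D (PowerSeries.coeff n p) := rfl

lemma coeff_ofPowerSeries_X_pow (n m : ℕ) :
    (ofPowerSeries α (PowerSeries.X ^ n)).coeff m = if m = n then 1 else 0 := by
  rw [coeff_ofPowerSeries, PowerSeries.coeff_X_pow]
  split <;> simp

lemma ofPowerSeries_injective [Nontrivial D] : Function.Injective (ofPowerSeries α) := by
  intro p q h
  ext n
  exact (algebraMap k D).injective (congrFun (congrArg coeff h) n)

lemma coeff_mul_X_pow (b : SkewPowerSeries α) (n m : ℕ) :
    (b * ofPowerSeries α (PowerSeries.X ^ n)).coeff (m + n) = b.coeff m := by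
  rw [coeff_mul, Finset.sum_eq_single (m, n)]
  · simp [coeff_ofPowerSeries_X_pow, -map_pow]
  · rintro ⟨i, j⟩ hp hne
    rw [Finset.HasAntidiagonal.mem_antidiagonal] at hp
    have : j ≠ n := by
      rintro rfl
      exact hne (by simp_all)
    simp [coeff_ofPowerSeries_X_pow, this, -map_pow]
  · simp

lemma coeff_X_pow_mul (b : SkewPowerSeries α) (n m : ℕ) :
    (ofPowerSeries α (PowerSeries.X ^ n) * b).coeff (n + m) = (α ^ n) (b.coeff m) := by
  rw [coeff_mul, Finset.sum_eq_single (n, m)]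
  · simp [coeff_ofPowerSeries_X_pow, -map_pow]
  · rintro ⟨i, j⟩ hp hne
    rw [Finset.HasAntidiagonal.mem_antidiagonal] at hp
    have : i ≠ n := by
      rintro rfl
      exact hne (by simp_all)
    simp [coeff_ofPowerSeries_X_pow, this, -map_pow]
  · simp

lemma X_pow_mem_orderIdeal (n : ℕ) : ofPowerSeries α (PowerSeries.X ^ n) ∈ orderIdeal α n :=
  fun m hm => by rw [coeff_ofPowerSeries_X_pow, if_neg hm.ne]

/-- With the power of `X` on the right, the quotient is a plain shift of coefficients, without any
twist by `α`. -/
lemma exists_mul_X_pow_eq {n : ℕ} {b : SkewPowerSeries α} (hb : b ∈ orderIdeal α n) :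
    ∃ a, a * ofPowerSeries α (PowerSeries.X ^ n) = b := by
  refine ⟨⟨fun m => b.coeff (m + n)⟩, ?_⟩
  ext m
  rcases lt_or_ge m n with h | h
  · rw [hb m h]
    exact (orderIdeal α n).mul_mem_left _ (X_pow_mem_orderIdeal n) m h
  · obtain ⟨m, rfl⟩ := Nat.exists_eq_add_of_le' h
    rw [coeff_mul_X_pow]

variable (α) in
lemma not_finiteDimensional [Nontrivial D] : ¬ FiniteDimensional k (SkewPowerSeries α) := fun _ =>
  PowerSeries.not_finiteDimensional k
    (Module.Finite.of_injective (ofPowerSeries α).toLinearMap ofPowerSeries_injective)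

/-- The infinite-dimensional subalgebra k[[X]] meets `I` in some p ≠ 0. Up to a unit, p is a power
of X, and all series of at least that order are left multiples of this power. -/
lemma exists_orderIdeal_le (I : Ideal (SkewPowerSeries α))
    [Module.Finite k (SkewPowerSeries α ⧸ I)] : ∃ n, orderIdeal α n ≤ I := by
  have hex : ∃ p : PowerSeries k, p ≠ 0 ∧ ofPowerSeries α p ∈ I := by
    by_contra! h
    let φ : PowerSeries k →ₗ[k] SkewPowerSeries α ⧸ I :=
      (Submodule.mkQ I).restrictScalars k ∘ₗ (ofPowerSeries α).toLinearMap
    refine PowerSeries.not_finiteDimensional k (Module.Finite.of_injective φ ?_)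
    refine (injective_iff_map_eq_zero φ).2 fun p hp => ?_
    by_contra h0
    exact h p h0 ((Submodule.Quotient.mk_eq_zero I).1 hp)
  obtain ⟨p, hp0, hp⟩ := hex
  obtain ⟨n, u, hu⟩ : ∃ (n : ℕ) (u : PowerSeries k), PowerSeries.X ^ n = u * p := by
    refine ⟨p.order.toNat, PowerSeries.Inv_divided_by_X_pow_order hp0, ?_⟩
    refine Eq.trans ?_ (congrArg _ (PowerSeries.X_pow_order_mul_divXPowOrder (f := p)))
    rw [mul_left_comm, PowerSeries.Inv_divided_by_X_pow_order_leftInv, mul_one]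
  refine ⟨n, fun b hb => ?_⟩
  obtain ⟨a, rfl⟩ := exists_mul_X_pow_eq hb
  rw [hu, map_mul]
  exact I.mul_mem_left _ (I.mul_mem_left _ hp)

/-- A coalgebra `E` with an algebra map `D[[x, α]] → E*` that makes it the finite dual of
`D[[x, α]]`. -/
structure IsFiniteDual {E : Type*} [AddCommGroup E] [Module k E] [Coalgebra k E]
    (φ : SkewPowerSeries α →ₐ[k] DualAlgebra k E) : Prop where
  exists_forall_eq_zero : ∀ f, ∃ n, ∀ b ∈ orderIdeal α n, φ b f = 0
  eq_zero : ∀ f, (∀ b, φ b f = 0) → f = 0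
  exists_coeff : ∀ (ℓ : Module.Dual k D) (n : ℕ), ∃ f, ∀ b, φ b f = ℓ (b.coeff n)

/-- The isomorphism `e` puts ordinary power series rings on the same footing as skew ones. -/
lemma isFiniteDual_finiteDual [FiniteDimensional k D] {A : Type*} [Ring A] [Algebra k A]
    (e : SkewPowerSeries α ≃ₐ[k] A) :
    IsFiniteDual ((finiteDual.evalHom k A).comp e.toAlgHom) where
  exists_forall_eq_zero f := by
    obtain ⟨f, I, hI, hI', hf⟩ := f
    have := finite_quotient_comap e.toAlgHom I
    obtain ⟨n, hn⟩ := exists_orderIdeal_le (k := k) (I.comap e.toAlgHom)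
    exact ⟨n, fun b hb => hf _ (hn hb)⟩
  eq_zero f hf := by
    refine Subtype.ext (LinearMap.ext fun a => ?_)
    have h : f.1 (e (e.symm a)) = 0 := hf (e.symm a)
    rwa [e.apply_symm_apply] at h
  exists_coeff ℓ n := by
    let g : Module.Dual k A :=
      { toFun := fun a => ℓ ((e.symm a).coeff n)
        map_add' := fun a b => by rw [map_add, coeff_add, map_add]
        map_smul' := fun r a => by rw [map_smul, coeff_smul, map_smul, RingHom.id_apply] }
    let J := (orderIdeal α (n + 1)).comap e.symm.toAlgHom
    refine ⟨⟨g, J, ?_, ?_, ?_⟩, fun b => ?_⟩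
    · exact ⟨fun b ha => by
        rw [Ideal.mem_comap, map_mul]
        exact (orderIdeal α (n + 1)).mul_mem_right _ ha⟩
    · exact finite_quotient_comap e.symm.toAlgHom (orderIdeal α (n + 1))
    · intro a ha
      change ℓ ((e.symm a).coeff n) = 0
      have h : (e.symm a).coeff n = 0 := ha n n.lt_succ_self
      rw [h, map_zero]
    · change ℓ ((e.symm (e b)).coeff n) = _
      rw [e.symm_apply_apply]

/-! ### The chain of truncated duals -/

section

variable {E : Type*} [AddCommGroup E] [Module k E] [Coalgebra k E]
  {φ : SkewPowerSeries α →ₐ[k] DualAlgebra k E}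

/-- The forms on `D[[x, α]]` that vanish on all series of order at least `n`. -/
def truncDual (φ : SkewPowerSeries α →ₐ[k] DualAlgebra k E) (n : ℕ) : Submodule k E where
  carrier := {f | ∀ b ∈ orderIdeal α n, φ b f = 0}
  zero_mem' b _ := map_zero (φ b).ofConv
  add_mem' hf hg b hb := by rw [map_add, hf b hb, hg b hb, add_zero]
  smul_mem' r f hf b hb := by rw [map_smul, hf b hb, smul_zero]

lemma truncDual_mono {m n : ℕ} (h : m ≤ n) : truncDual φ m ≤ truncDual φ n :=
  fun _ hf b hb => hf b (orderIdeal_anti h hb)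

lemma IsFiniteDual.exists_mem_truncDual (hφ : IsFiniteDual φ) (f : E) :
    ∃ n, f ∈ truncDual φ n :=
  hφ.exists_forall_eq_zero f

lemma IsFiniteDual.truncDual_zero (hφ : IsFiniteDual φ) : truncDual φ 0 = ⊥ := by
  rw [eq_bot_iff]
  intro f hf
  rw [Submodule.mem_bot]
  refine hφ.eq_zero f fun b => hf b fun m hm => ?_
  lia

/-- An arbitrary functional need not come from a series, so the ideal property is applied on the
other side: series of order at least `n` kill `f` under the right action. -/
lemma IsFiniteDual.isRightCoideal_truncDual (hφ : IsFiniteDual φ) (n : ℕ) :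
    IsRightCoideal k (truncDual φ n) := by
  rw [isRightCoideal_iff]
  intro g f hf a ha
  have h : DualAlgebra.rightAct (φ a) f = 0 := hφ.eq_zero _ fun b => by
    rw [DualAlgebra.apply_rightAct, ← map_mul]
    exact hf _ ((orderIdeal α n).mul_mem_right b ha)
  rw [DualAlgebra.apply_leftAct, ← DualAlgebra.apply_rightAct, h, map_zero]

/-- A form in `truncDual φ n` is a form on the quotient by the series of order at least `n`. -/
def truncDualToDual (φ : SkewPowerSeries α →ₐ[k] DualAlgebra k E) (n : ℕ) :
    truncDual φ n →ₗ[k] Module.Dual k (SkewPowerSeries α ⧸ (orderIdeal α n).restrictScalars k) where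
  toFun f := Submodule.liftQ _
    { toFun := fun b => φ b f
      map_add' := fun a b => by rw [map_add]; rfl
      map_smul' := fun r b => by rw [map_smul]; rfl } f.2
  map_add' f g := by
    ext b
    exact map_add (φ b).ofConv _ _
  map_smul' r f := by
    ext b
    exact map_smul (φ b).ofConv _ _

lemma IsFiniteDual.truncDualToDual_injective (hφ : IsFiniteDual φ) (n : ℕ) :
    Function.Injective (truncDualToDual φ n) := by
  refine (injective_iff_map_eq_zero _).2 fun f h => ?_
  exact Subtype.ext (hφ.eq_zero _ fun b => LinearMap.congr_fun h (Submodule.Quotient.mk b))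

lemma IsFiniteDual.ext (hφ : IsFiniteDual φ) {a b : SkewPowerSeries α}
    (h : ∀ f, φ a f = φ b f) : a = b := by
  ext n
  rw [← sub_eq_zero, ← Module.forall_dual_apply_eq_zero_iff k]
  intro ℓ
  obtain ⟨f, hf⟩ := hφ.exists_coeff ℓ n
  rw [map_sub, sub_eq_zero, ← hf, ← hf, h]

lemma IsFiniteDual.not_finiteDimensional [Nontrivial D] (hφ : IsFiniteDual φ) :
    ¬ FiniteDimensional k E := by
  intro h
  let ψ : SkewPowerSeries α →ₗ[k] Module.Dual k E :=
    { toFun := fun b => (φ b).ofConv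
      map_add' := fun a b => by rw [map_add]; rfl
      map_smul' := fun r b => by rw [map_smul]; rfl }
  exact SkewPowerSeries.not_finiteDimensional α (Module.Finite.of_injective ψ fun a b hab =>
    hφ.ext fun f => LinearMap.congr_fun hab f)

variable [FiniteDimensional k D]

instance finiteDimensional_quotient_restrictScalars (n : ℕ) :
    FiniteDimensional k (SkewPowerSeries α ⧸ (orderIdeal α n).restrictScalars k) :=
  Module.Finite.equiv (Submodule.Quotient.restrictScalarsEquiv k (orderIdeal α n)).symm

lemma IsFiniteDual.finiteDimensional_truncDual (hφ : IsFiniteDual φ) (n : ℕ) :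
    FiniteDimensional k (truncDual φ n) :=
  Module.Finite.of_injective _ (hφ.truncDualToDual_injective n)

/-- The series alone already move `f` everywhere: the kernel of b ↦ b · f lies in the order ideal of
`n + 1`, so the orbit has at least the dimension of the truncated dual. -/
lemma IsFiniteDual.truncDual_le_of_mem (hφ : IsFiniteDual φ)
    (hD : ∀ w : D, w ≠ 0 → ∃ v, v * w = 1) {n : ℕ} {f : E} (hf : f ∈ truncDual φ (n + 1))
    (hf' : f ∉ truncDual φ n) {N : Submodule k E} (hN : IsRightCoideal k N) (hfN : f ∈ N) :
    truncDual φ (n + 1) ≤ N := by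
  have := hφ.finiteDimensional_truncDual (n + 1)
  let I := (orderIdeal α (n + 1)).restrictScalars k
  let L : SkewPowerSeries α →ₗ[k] truncDual φ (n + 1) :=
    { toFun := fun b => ⟨DualAlgebra.leftAct (φ b) f,
        (hφ.isRightCoideal_truncDual (n + 1)).leftAct_mem _ hf⟩
      map_add' := fun a b => Subtype.ext <|
        (congrArg (DualAlgebra.leftAct · f) (map_add φ a b)).trans
          (DualAlgebra.leftAct_add _ _ f)
      map_smul' := fun r b => Subtype.ext <|
        (congrArg (DualAlgebra.leftAct · f) (map_smul φ r b)).trans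
          (DualAlgebra.leftAct_smul r _ f) }
  have hL : ∀ b c, φ c (L b).1 = φ (c * b) f := fun b c => by
    rw [map_mul, ← DualAlgebra.apply_leftAct]
    rfl
  have hker : LinearMap.ker L ≤ I := by
    intro b hb
    by_contra hbI
    have hb0 : ∀ c, φ (c * b) f = 0 := fun c => by
      rw [← hL, LinearMap.mem_ker.1 hb]
      exact map_zero (φ c).ofConv
    have hex : ∃ j, j < n + 1 ∧ b.coeff j ≠ 0 := by
      by_contra! h
      exact hbI h
    classical
    obtain ⟨hj, hbj⟩ := Nat.find_spec hex
    have hmin : ∀ i < Nat.find hex, b.coeff i = 0 := fun i hi => by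
      by_contra h
      exact Nat.find_min hex hi ⟨by lia, h⟩
    generalize Nat.find hex = j at hj hbj hmin
    obtain ⟨m, rfl⟩ : ∃ m, n = m + j := Nat.exists_eq_add_of_le' (by lia)
    -- If `b` of order j ≤ n killed `f`, then X^(n-j) b would have order exactly n with
    -- left-invertible leading coefficient. Every `c` of order at least n would be a left multiple
    -- of `b` modulo order n + 1, forcing `f` into `truncDual φ n`.
    let b' := ofPowerSeries α (PowerSeries.X ^ m) * b
    have hb' : b' ∈ orderIdeal α (m + j) := by
      intro i hi
      rcases lt_or_ge i m with h | h
      · exact (orderIdeal α m).mul_mem_right b (X_pow_mem_orderIdeal m) i h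
      · obtain ⟨i, rfl⟩ := Nat.exists_eq_add_of_le h
        rw [coeff_X_pow_mul, hmin i (by lia), map_zero]
    have hlead : b'.coeff (m + j) ≠ 0 := by
      rw [coeff_X_pow_mul]
      exact (map_ne_zero_iff _ (α ^ m).injective).2 hbj
    obtain ⟨v, hv⟩ := hD _ hlead
    apply hf'
    intro c hc
    -- A constant factor, chosen so that `w * b'` and `c` have the same coefficient in degree `m +
    -- j`.
    let w : SkewPowerSeries α := ⟨Pi.single 0 (c.coeff (m + j) * v)⟩
    have hw : ∀ i, (w * b').coeff i = c.coeff (m + j) * v * b'.coeff i := by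
      intro i
      rw [coeff_mul, Finset.sum_eq_single (0, i)]
      · simp [w]
      · rintro ⟨p, q⟩ hp hne
        rw [Finset.HasAntidiagonal.mem_antidiagonal] at hp
        have : p ≠ 0 := by
          rintro rfl
          exact hne (by simp_all)
        simp [w, this]
      · simp
    have hsub : c - w * b' ∈ orderIdeal α (m + j + 1) := by
      intro i hi
      have : (c - w * b').coeff i = c.coeff i - (w * b').coeff i := rfl
      rw [this, hw]
      rcases Nat.lt_succ_iff_lt_or_eq.1 hi with h | rfl
      · rw [hc i h, hb' i h, mul_zero, sub_zero]
      · rw [mul_assoc, hv, mul_one, sub_self]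
    have h1 := hf _ hsub
    rw [map_sub, WithConv.ofConv_sub, LinearMap.sub_apply, ← mul_assoc, hb0, sub_zero] at h1
    exact h1
  have hsurj : Function.Surjective L := by
    rw [← LinearMap.range_eq_top]
    refine Submodule.eq_top_of_finrank_eq (le_antisymm (Submodule.finrank_le _) ?_)
    have h1 := LinearMap.finrank_le_finrank_of_injective (hφ.truncDualToDual_injective (n + 1))
    rw [Subspace.dual_finrank_eq] at h1
    refine h1.trans ?_
    rw [← L.quotKerEquivRange.finrank_eq]
    have hfin : FiniteDimensional k (SkewPowerSeries α ⧸ LinearMap.ker L) :=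
      Module.Finite.equiv L.quotKerEquivRange.symm
    exact LinearMap.finrank_le_finrank_of_surjective (f := Submodule.factor hker)
      (Submodule.factor_surjective hker)
  intro g hg
  obtain ⟨b, hb⟩ := hsurj ⟨g, hg⟩
  have : DualAlgebra.leftAct (φ b) f = g := congrArg Subtype.val hb
  exact this ▸ hN.leftAct_mem _ hfN

/-- The truncated duals are consecutive in the chain of right coideals of `D[[x, α]]°`. -/
lemma IsFiniteDual.isNextCoideal_truncDual [Nontrivial D] (hφ : IsFiniteDual φ)
    (hD : ∀ w : D, w ≠ 0 → ∃ v, v * w = 1) (n : ℕ) :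
    IsNextCoideal (truncDual φ n) (truncDual φ (n + 1)) where
  isRightCoideal := hφ.isRightCoideal_truncDual _
  finiteDimensional := hφ.finiteDimensional_truncDual _
  lt := by
    refine lt_of_le_of_ne (truncDual_mono n.le_succ) fun h => ?_
    -- Strictness is witnessed by the form reading `ℓ` off the n-th coefficient, which is nonzero at
    -- X^n.
    obtain ⟨ℓ, hℓ⟩ := Module.Projective.exists_dual_ne_zero k (one_ne_zero : (1 : D) ≠ 0)
    obtain ⟨f, hf⟩ := hφ.exists_coeff ℓ n
    have hmem : f ∈ truncDual φ (n + 1) := fun b hb => by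
      rw [hf, hb n n.lt_succ_self, map_zero]
    rw [← h] at hmem
    apply hℓ
    rw [← hmem _ (X_pow_mem_orderIdeal n), hf, coeff_ofPowerSeries_X_pow, if_pos rfl]
  le_of_not_le N hN h := by
    obtain ⟨f, hfN, hf⟩ := SetLike.not_le_iff_exists.1 h
    classical
    have hex := hφ.exists_mem_truncDual f
    have h1 := Nat.find_spec hex
    have hlt : n < Nat.find hex := by
      by_contra hle
      exact hf (truncDual_mono (by lia) h1)
    obtain ⟨m, hm⟩ : ∃ m, Nat.find hex = m + 1 := ⟨Nat.find hex - 1, by lia⟩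
    have h2 : f ∉ truncDual φ m := Nat.find_min hex (by lia)
    rw [hm] at h1
    exact (truncDual_mono (by lia)).trans (hφ.truncDual_le_of_mem hD h1 h2 hN hfN)

lemma IsFiniteDual.isSmallestCoideal_truncDual [Nontrivial D] (hφ : IsFiniteDual φ)
    (hD : ∀ w : D, w ≠ 0 → ∃ v, v * w = 1) :
    IsSmallestCoideal (truncDual φ 1) := by
  have h := hφ.isNextCoideal_truncDual hD 0
  rwa [hφ.truncDual_zero] at h

/-- Let f ∈ M \ N first appear in the truncated dual of index m + 1. Then that truncated dual is
contained in M, while N stays within the one of index m. -/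
lemma IsFiniteDual.isChainCoalgebra [Nontrivial D] (hφ : IsFiniteDual φ)
    (hD : ∀ w : D, w ≠ 0 → ∃ v, v * w = 1) :
    IsChainCoalgebra k E := by
  intro M N hM hN
  by_cases h : M ≤ N
  · exact Or.inl h
  right
  obtain ⟨f, hfM, hfN⟩ := SetLike.not_le_iff_exists.1 h
  classical
  have hex := hφ.exists_mem_truncDual f
  have h1 := Nat.find_spec hex
  obtain ⟨m, hm⟩ : ∃ m, Nat.find hex = m + 1 := Nat.exists_eq_succ_of_ne_zero fun h => hfN <| by
    rw [h, hφ.truncDual_zero, Submodule.mem_bot] at h1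
    rw [h1]
    exact N.zero_mem
  have h2 : f ∉ truncDual φ m := Nat.find_min hex (by lia)
  rw [hm] at h1
  have hNle : N ≤ truncDual φ m := by
    by_contra hle
    exact hfN ((hφ.isNextCoideal_truncDual hD m).le_of_not_le N hN hle h1)
  refine hNle.trans ((truncDual_mono m.le_succ).trans ?_)
  exact (hφ.isNextCoideal_truncDual hD m).le_of_not_le M hM fun hle => h2 (hle hfM)

-- A form that ignores all terms of positive order is a form on the constants D.
omit [FiniteDimensional k D] in
lemma IsFiniteDual.finrank_truncDual_one (hφ : IsFiniteDual φ) :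
    Module.finrank k (truncDual φ 1) = Module.finrank k D := by
  let j : D →ₗ[k] SkewPowerSeries α :=
    { toFun := fun w => ⟨Pi.single 0 w⟩
      map_add' := fun v w => by
        ext n
        exact congrFun (Pi.single_add (f := fun _ : ℕ => D) 0 v w) n
      map_smul' := fun r w => by
        ext n
        exact congrFun (Pi.single_smul (f := fun _ : ℕ => D) 0 r w) n }
  let ψ : truncDual φ 1 →ₗ[k] Module.Dual k D :=
    { toFun := fun f =>
        { toFun := fun w => φ (j w) f
          map_add' := fun a b => by rw [map_add, map_add]; rfl
          map_smul' := fun r b => by rw [map_smul, map_smul]; rfl }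
      map_add' := fun f g => by
        ext w
        exact map_add (φ (j w)).ofConv _ _
      map_smul' := fun r f => by
        ext w
        exact map_smul (φ (j w)).ofConv _ _ }
  have hψ : Function.Bijective ψ := by
    constructor
    · refine (injective_iff_map_eq_zero _).2 fun f hf => Subtype.ext (hφ.eq_zero _ fun b => ?_)
      have h1 : φ (j (b.coeff 0)) f = 0 := LinearMap.congr_fun hf (b.coeff 0)
      have h2 := f.2 (b - j (b.coeff 0)) fun m hm => by
        obtain rfl : m = 0 := by lia
        change b.coeff 0 - (Pi.single 0 (b.coeff 0) : ℕ → D) 0 = 0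
        simp
      rwa [map_sub, WithConv.ofConv_sub, LinearMap.sub_apply, h1, sub_zero] at h2
    · intro ℓ
      obtain ⟨f, hf⟩ := hφ.exists_coeff ℓ 0
      refine ⟨⟨f, fun b hb => by rw [hf, hb 0 one_pos, map_zero]⟩, ?_⟩
      ext w
      change φ (j w) f = ℓ w
      rw [hf]
      simp [j]
  rw [(LinearEquiv.ofBijective ψ hψ).finrank_eq, Subspace.dual_finrank_eq]

/-- The dimension of the coefficient ring is an invariant of the coalgebra. -/
lemma IsFiniteDual.finrank_le_of_coalgHom {D' E' : Type*} [Ring D'] [Algebra k D']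
    [FiniteDimensional k D'] [Nontrivial D] [Nontrivial D'] [AddCommGroup E'] [Module k E']
    [Coalgebra k E'] {α' : D' ≃ₐ[k] D'} {φ' : SkewPowerSeries α' →ₐ[k] DualAlgebra k E'}
    (hφ : IsFiniteDual φ) (hφ' : IsFiniteDual φ')
    (hD : ∀ w : D, w ≠ 0 → ∃ v, v * w = 1) (hD' : ∀ w : D', w ≠ 0 → ∃ v, v * w = 1)
    (F : E →ₗc[k] E') (hF : Function.Injective F) :
    Module.finrank k D' ≤ Module.finrank k D := by
  have hS := hφ.isSmallestCoideal_truncDual hD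
  have hS' := hφ'.isSmallestCoideal_truncDual hD'
  have := hS.finiteDimensional
  -- The image of the smallest coideal is a nonzero coideal, so it contains the smallest coideal of
  -- the target.
  have hle := hS'.le (hS.isRightCoideal.map_coalgHom F) (fun h => hS.lt.ne' <| by
    rw [eq_bot_iff]
    intro f hf
    rw [Submodule.mem_bot]
    refine hF (((Submodule.mem_bot k).1 (h ▸ Submodule.mem_map_of_mem hf)).trans ?_)
    rw [map_zero])
  have h1 := (Submodule.finrank_mono hle).trans (Submodule.finrank_map_le _ _)
  rwa [hφ.finrank_truncDual_one, hφ'.finrank_truncDual_one] at h1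

end

end SkewPowerSeries

open DualAlgebra in
/-- A chain coalgebra is isomorphic to `D[[x, α]]°` if its dual algebra contains a copy of `D`
that is a complement of the functionals vanishing on the smallest coideal, and a suitable `x`. -/
theorem nonempty_coalgEquiv_finiteDual {k C : Type*} [Field k] [AddCommGroup C] [Module k C]
    [Coalgebra k C] (hinf : ¬ FiniteDimensional k C)
    {D : Type*} [Ring D] [Algebra k D] [FiniteDimensional k D] {α : D ≃ₐ[k] D}
    {A : Type*} [Ring A] [Algebra k A] (e : SkewPowerSeries α ≃ₐ[k] A)
    (hC' : IsChainCoalgebra k (finiteDual k A))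
    {S T : Submodule k C} (hT : IsNextCoideal S T)
    (ι : D →ₐ[k] DualAlgebra k C)
    (hι : ∀ f : DualAlgebra k C, ∃ w, ∀ c ∈ S, ι w c = f c)
    {x : DualAlgebra k C} (hx : x.IsLocallyNilpotent) {d : C} (hd : d ∈ T) (hxd : x d ≠ 0)
    (hxι : ∀ w, x * ι w = ι (α w) * x) :
    Nonempty (C ≃ₗc[k] finiteDual k A) := by
  let F := coalgHomToFiniteDual ((evalHom ι hx hxι).comp e.symm.toAlgHom) fun c => by
    obtain ⟨n, hn⟩ := exists_evalHom_apply_eq_zero ι hx hxι c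
    refine ⟨(SkewPowerSeries.orderIdeal α n).comap e.symm.toAlgHom, ⟨fun b ha => ?_⟩,
      finite_quotient_comap _ _, fun a ha => hn _ ha⟩
    rw [Ideal.mem_comap, map_mul]
    exact (SkewPowerSeries.orderIdeal α n).mul_mem_right _ ha
  have hF : Function.Injective F := by
    refine (injective_iff_map_eq_zero F).2 fun c hc => ?_
    by_contra hc0
    have h0 : ∀ w m, (ι w * x ^ m) c = 0 := fun w m => by
      have h : (F c).1 (e ⟨Pi.single m w⟩) = 0 := by
        rw [hc]
        rfl
      change evalHom ι hx hxι (e.symm (e _)) c = 0 at h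
      rwa [e.symm_apply_apply, evalHom_single] at h
    have hex : ∃ m, rightAct (x ^ m) c = 0 := by
      obtain ⟨n, hn⟩ := hx c
      refine ⟨n, ext_of_forall_apply (k := k) fun f => ?_⟩
      rw [apply_rightAct, map_zero]
      exact (hn n le_rfl f).2
    classical
    -- Take the last m with c · x^m ≠ 0. This vector is killed by x, so it lies in S, where every
    -- functional agrees with some ι(w). But (x^m ι(w))(c) = (ι(α^m(w)) x^m)(c) = 0, a
    -- contradiction.
    obtain ⟨m, hm⟩ : ∃ m, Nat.find hex = m + 1 := Nat.exists_eq_succ_of_ne_zero fun h => hc0 <| by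
      have := Nat.find_spec hex
      rwa [h, pow_zero, rightAct_one] at this
    have h1 := Nat.find_spec hex
    rw [hm, pow_succ, rightAct_mul] at h1
    have h2 : rightAct (x ^ m) c ≠ 0 := Nat.find_min hex (by lia)
    have hmem := hT.mem_of_rightAct_eq_zero hd hxd h1
    refine h2 (ext_of_forall_apply (k := k) fun f => ?_)
    obtain ⟨w, hw⟩ := hι f
    rw [← hw _ hmem, apply_rightAct, pow_mul_eq_map_mul_pow ι hxι, h0, map_zero]
  exact ⟨CoalgEquiv.ofBijective (hC'.bijective_of_injective hinf F hF)⟩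

/-! ### Finite-dimensional real division algebras -/

section Frobenius

variable {D : Type*} [Ring D] [Algebra ℝ D]

lemma eq_zero_of_eq_neg_real {V : Type*} [AddCommGroup V] [Module ℝ V] {v : V} (h : v = -v) :
    v = 0 := by
  have h2 : (2 : ℝ) • v = 0 := by
    rw [two_smul]
    exact add_eq_zero_iff_eq_neg.2 h
  exact (smul_eq_zero.1 h2).resolve_left two_ne_zero

/-- The minimal polynomial is irreducible over ℝ, hence of degree at most 2; complete the square. -/
lemma exists_shift_sq_eq_smul_one [Nontrivial D] [NoZeroDivisors D] [FiniteDimensional ℝ D]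
    (a : D) : ∃ p r : ℝ, (a - p • 1) * (a - p • 1) = r • 1 := by
  have : IsDomain D := NoZeroDivisors.to_isDomain D
  have hint : IsIntegral ℝ a := IsIntegral.of_finite ℝ a
  have hdeg := (minpoly.irreducible hint).natDegree_le_two
  have hroot := minpoly.aeval ℝ a
  have hmonic := minpoly.monic hint
  rw [Polynomial.aeval_eq_sum_range] at hroot
  have hpos := minpoly.natDegree_pos hint
  have hlead := hmonic.coeff_natDegree
  obtain h | h : (minpoly ℝ a).natDegree = 1 ∨ (minpoly ℝ a).natDegree = 2 := by lia
  · rw [h] at hroot hlead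
    simp only [Finset.sum_range_succ, Finset.sum_range_zero, hlead, zero_add, pow_zero, pow_one,
      one_smul] at hroot
    refine ⟨-(minpoly ℝ a).coeff 0, 0, ?_⟩
    have : a - (-(minpoly ℝ a).coeff 0) • (1 : D) = 0 := by
      rw [← hroot]
      module
    rw [this]
    simp
  · rw [h] at hroot hlead
    simp only [Finset.sum_range_succ, Finset.sum_range_zero, hlead, zero_add, pow_zero, pow_one,
      one_smul] at hroot
    generalize (minpoly ℝ a).coeff 0 = c at hroot
    generalize (minpoly ℝ a).coeff 1 = b at hroot
    refine ⟨-b / 2, b ^ 2 / 4 - c, ?_⟩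
    have h2 : a * a = -(c • (1 : D)) - b • a := by
      rw [← sub_eq_zero, ← hroot, sq]
      module
    simp only [sub_mul, mul_sub, smul_mul_assoc, mul_smul_comm, one_mul, mul_one, h2]
    module

lemma eq_smul_one_of_sq_eq_smul_one [NoZeroDivisors D] {v : D} {r : ℝ} (hr : 0 ≤ r)
    (hv : v * v = r • 1) : ∃ s : ℝ, v = s • 1 := by
  obtain ⟨s, rfl⟩ : ∃ s, r = s * s := ⟨√r, (Real.mul_self_sqrt hr).symm⟩
  have h : (v - s • 1) * (v + s • 1) = 0 := by
    simp only [sub_mul, mul_add, smul_mul_assoc, mul_smul_comm, one_mul, mul_one, hv]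
    module
  rcases mul_eq_zero.1 h with h | h
  · exact ⟨s, sub_eq_zero.1 h⟩
  · exact ⟨-s, by rw [neg_smul]; exact eq_neg_of_add_eq_zero_left h⟩

lemma smul_mul_smul_eq_neg_one {v : D} {r : ℝ} (hr : r < 0) (hv : v * v = r • 1) :
    ((√(-r))⁻¹ • v) * ((√(-r))⁻¹ • v) = -1 := by
  have h : (√(-r))⁻¹ * (√(-r))⁻¹ = (-r)⁻¹ := by
    rw [← mul_inv, Real.mul_self_sqrt (by linarith)]
  rw [smul_mul_smul_comm, hv, h, smul_smul, inv_neg, neg_mul, inv_mul_cancel₀ hr.ne, neg_smul,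
    one_smul]

/-- The shifted element v has a real square. If v² = -s², then (v - si)(v + si) = 0 because v
commutes with `i`. -/
lemma eq_add_smul_of_commute [Nontrivial D] [NoZeroDivisors D] [FiniteDimensional ℝ D] {i : D}
    (hi : i * i = -1) {b : D} (hb : i * b = b * i) : ∃ x y : ℝ, b = x • 1 + y • i := by
  obtain ⟨p, r, hr⟩ := exists_shift_sq_eq_smul_one b
  rcases le_or_gt 0 r with h | h
  · obtain ⟨s, hs⟩ := eq_smul_one_of_sq_eq_smul_one h hr
    exact ⟨p + s, 0, by rw [sub_eq_iff_eq_add.1 hs]; module⟩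
  · set v := b - p • (1 : D) with hv
    have hcomm : i * v = v * i := by
      simp [hv, mul_sub, sub_mul, hb]
    obtain ⟨s, rfl⟩ : ∃ s, r = -(s * s) :=
      ⟨√(-r), by rw [Real.mul_self_sqrt (by linarith), neg_neg]⟩
    have h0 : (v - s • i) * (v + s • i) = 0 := by
      simp only [sub_mul, mul_add, smul_mul_assoc, mul_smul_comm, hr, hi, hcomm]
      module
    rcases mul_eq_zero.1 h0 with h1 | h1
    · refine ⟨p, s, ?_⟩
      rw [← sub_eq_zero.1 h1, hv]
      abel
    · refine ⟨p, -s, ?_⟩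
      rw [neg_smul, ← eq_neg_of_add_eq_zero_left h1, hv]
      abel

/-- Frobenius' theorem on finite-dimensional real division algebras. -/
theorem frobenius_real_division_algebra (D : Type*) [Ring D] [Algebra ℝ D] [Nontrivial D]
    [NoZeroDivisors D] [FiniteDimensional ℝ D] :
    (∀ a : D, ∃ x : ℝ, a = x • 1) ∨
      (∃ i : D, i * i = -1 ∧ ∀ a : D, ∃ x y : ℝ, a = x • 1 + y • i) ∨
      (∃ i j : D, i * i = -1 ∧ j * j = -1 ∧ i * j = -(j * i) ∧
        ∀ a : D, ∃ x y z w : ℝ, a = x • 1 + y • i + z • j + w • (i * j)) := by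
  by_cases h1 : ∀ a : D, ∃ x : ℝ, a = x • 1
  · exact Or.inl h1
  right
  push Not at h1
  obtain ⟨a, ha⟩ := h1
  obtain ⟨p, r, hr⟩ := exists_shift_sq_eq_smul_one a
  have hr0 : r < 0 := by
    by_contra! h
    obtain ⟨s, hs⟩ := eq_smul_one_of_sq_eq_smul_one h hr
    exact ha (p + s) (by rw [sub_eq_iff_eq_add.1 hs]; module)
  obtain ⟨i, hi⟩ : ∃ i : D, i * i = -1 := ⟨_, smul_mul_smul_eq_neg_one hr0 hr⟩
  clear hr0 hr p r ha a
  by_cases h2 : ∀ a : D, ∃ x y : ℝ, a = x • 1 + y • i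
  · exact Or.inl ⟨i, hi, h2⟩
  right
  have hi' : ∀ u : D, i * (i * u) = -u := fun u => by rw [← mul_assoc, hi, neg_one_mul]
  have hi0 : i ≠ 0 := by
    rintro rfl
    simp at hi
  have hplus : ∀ a : D, i * (a - i * a * i) = (a - i * a * i) * i := fun a => by
    simp only [mul_sub, sub_mul, mul_assoc, hi', hi, mul_neg, mul_one]
    abel
  have hminus : ∀ a : D, i * (a + i * a * i) = -((a + i * a * i) * i) := fun a => by
    simp only [mul_add, add_mul, mul_assoc, hi', hi, mul_neg, mul_one]
    abel
  have hsplit : ∀ a : D, a = (1 / 2 : ℝ) • (a - i * a * i) + (1 / 2 : ℝ) • (a + i * a * i) :=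
    fun a => by module
  push Not at h2
  obtain ⟨a, ha⟩ := h2
  -- Twice the part of `a` that anticommutes with `i`; it is nonzero since the commuting part lies
  -- in ℝ + ℝi.
  set u := a + i * a * i with hu
  have hu0 : u ≠ 0 := by
    intro h
    obtain ⟨x, y, hxy⟩ := eq_add_smul_of_commute hi (hplus a)
    refine ha (1 / 2 * x) (1 / 2 * y) ?_
    rw [hsplit a, ← hu, h, hxy]
    module
  have hui : i * u = -(u * i) := hminus a
  have hunot : ∀ s : ℝ, u ≠ s • 1 := by
    rintro s hs
    rw [hs] at hui
    simp only [mul_smul_comm, mul_one, smul_mul_assoc, one_mul] at hui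
    have : s • i = 0 := eq_zero_of_eq_neg_real hui
    rcases smul_eq_zero.1 this with h | h
    · exact hu0 (by rw [hs, h, zero_smul])
    · exact hi0 h
  obtain ⟨x, y, hxy⟩ := eq_add_smul_of_commute hi (b := u * u) (by
    rw [← mul_assoc, hui, neg_mul, mul_assoc, hui, mul_neg, neg_neg, mul_assoc])
  -- `u` commutes with u² = x + yi but anticommutes with `i`.
  have hy : y = 0 := by
    have h : u * (u * u) = u * u * u := (mul_assoc _ _ _).symm
    rw [hxy] at h
    simp only [mul_add, add_mul, mul_smul_comm, smul_mul_assoc, mul_one, one_mul, hui,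
      add_right_inj, smul_neg] at h
    have h0 : y • (u * i) = 0 := eq_zero_of_eq_neg_real h
    rcases smul_eq_zero.1 h0 with h | h
    · exact h
    · exact absurd h (mul_ne_zero hu0 hi0)
  rw [hy, zero_smul, add_zero] at hxy
  have hx : x < 0 := by
    by_contra! h
    obtain ⟨s, hs⟩ := eq_smul_one_of_sq_eq_smul_one h hxy
    exact hunot s hs
  obtain ⟨j, hj, hij⟩ : ∃ j : D, j * j = -1 ∧ i * j = -(j * i) :=
    ⟨_, smul_mul_smul_eq_neg_one hx hxy, by
      rw [mul_smul_comm, hui, smul_mul_assoc, smul_neg]⟩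
  refine ⟨i, j, hi, hj, hij, fun b => ?_⟩
  obtain ⟨x, y, h1⟩ := eq_add_smul_of_commute hi (hplus b)
  have h3 := hminus b
  set c := b + i * b * i with hc
  -- Multiplication by `j` turns the anticommuting part `c` into an element of the centralizer ℝ +
  -- ℝi.
  obtain ⟨z, w, h2⟩ := eq_add_smul_of_commute hi (b := c * j) (by
    rw [← mul_assoc, h3, neg_mul, mul_assoc, hij, mul_neg, neg_neg, mul_assoc])
  have h4 : c = -(z • j + w • (i * j)) := by
    have : c * j * j = -c := by rw [mul_assoc, hj, mul_neg_one]
    rw [h2] at this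
    rw [← neg_eq_iff_eq_neg, ← this]
    simp only [add_mul, smul_mul_assoc, one_mul]
  refine ⟨1 / 2 * x, 1 / 2 * y, -(1 / 2) * z, -(1 / 2) * w, ?_⟩
  rw [hsplit b, ← hc, h1, h4]
  module

end Frobenius

/-! ### Evaluation of power series over the ground field -/

section Subst

open DualAlgebra

variable {k C : Type*} [Field k] [AddCommGroup C] [Module k C] [Coalgebra k C]
  {t : DualAlgebra k C} (ht : t.IsLocallyNilpotent)

namespace DualAlgebra

/-- Evaluation of power series over `k` at a topologically nilpotent element of `C*`. -/
def substHom : PowerSeries k →ₐ[k] DualAlgebra k C :=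
  (evalHom (α := (AlgEquiv.refl : k ≃ₐ[k] k)) (Algebra.ofId k _) ht
    fun w => (Algebra.commutes w t).symm).comp (SkewPowerSeries.ofPowerSeries _)

lemma substHom_eq_eval (p : PowerSeries k) :
    substHom ht p = eval (Algebra.ofId k _) ht fun n => PowerSeries.coeff n p := rfl

lemma substHom_X : substHom ht PowerSeries.X = t := by
  have h : (fun n => PowerSeries.coeff n (PowerSeries.X : PowerSeries k)) = Pi.single 1 1 := by
    ext n
    simp [PowerSeries.coeff_X, Pi.single_apply]
  rw [substHom_eq_eval, h, eval_single, map_one, one_mul, pow_one]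

lemma commute_substHom {g : DualAlgebra k C} (hg : Commute g t) (p : PowerSeries k) :
    Commute g (substHom ht p) :=
  commute_eval _ ht hg fun m => (Algebra.commutes (PowerSeries.coeff m p) g).symm

/-- Where the left ideal generated by `t` vanishes, a power series in `t` with constant
coefficient `1` agrees with `1`. -/
lemma substHom_apply_of_forall_eq_zero (p : PowerSeries k) (hp : PowerSeries.coeff 0 p = 1) {c : C}
    (hc : ∀ f : DualAlgebra k C, (f * t) c = 0) : (substHom ht p - 1) c = 0 := by
  obtain ⟨n, hn, hn1⟩ := ((eventually_eval_apply (Algebra.ofId k _) ht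
    (fun n => PowerSeries.coeff n p) c).and (Filter.eventually_ge_atTop 1)).exists
  rw [WithConv.ofConv_sub, LinearMap.sub_apply, substHom_eq_eval, hn, partialEval_apply,
    Finset.sum_eq_single 0]
  · rw [hp, map_one, pow_zero, mul_one, sub_self]
  · intro m _ hm
    obtain ⟨m, rfl⟩ := Nat.exists_eq_succ_of_ne_zero hm
    rw [pow_succ, ← mul_assoc]
    exact hc _
  · intro h
    simp at h
    lia

end DualAlgebra

end Subst

/-! ### Lifting along the quotient by the functionals vanishing on the smallest coideal -/

section Lifting

open DualAlgebra

variable {C : Type*} [AddCommGroup C] [Module ℝ C] [Coalgebra ℝ C] {S T : Submodule ℝ C}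

/-- The series is (1 + X)^(-1/2); exponents of binomial series add. -/
lemma PowerSeries.exists_mul_self_mul_one_add_X :
    ∃ q : PowerSeries ℝ, q * q * (1 + PowerSeries.X) = 1 ∧ PowerSeries.coeff 0 q = 1 := by
  refine ⟨PowerSeries.binomialSeries ℝ (-1 / 2 : ℝ), ?_, ?_⟩
  · have h1 := PowerSeries.binomialSeries_nat (R := ℝ) (A := ℝ) 1
    rw [pow_one] at h1
    rw [← h1, ← PowerSeries.binomialSeries_add, ← PowerSeries.binomialSeries_add]
    norm_num
  · simp

lemma mul_mul_mul_eq_neg_one {R : Type*} [Ring R] {u s : R} (h : u * s = s * u)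
    (h1 : s * s * (1 + -(u * u + 1)) = 1) : u * s * (u * s) = -1 := by
  have h3 : u * s * (u * s) = s * s * (u * u) := by
    rw [h, mul_assoc s u, ← mul_assoc u s, h, mul_assoc s u, mul_assoc s s]
  have h4 : 1 + -(u * u + 1) = -(u * u) := by abel
  rw [h3, ← h1, h4, mul_neg, neg_neg]

/-- If `u² = -1` on the smallest coideal, then `u` can be corrected to a square root of `-1`. -/
lemma IsSmallestCoideal.exists_mul_self_eq_neg_one (hC : IsChainCoalgebra ℝ C)
    (hS : IsSmallestCoideal S) {u : DualAlgebra ℝ C} (hu : ∀ c ∈ S, (u * u + 1) c = 0) :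
    ∃ s : DualAlgebra ℝ C, u * s * (u * s) = -1 ∧ (∀ c ∈ S, (u * s) c = u c) ∧
      ∀ g, Commute g (u * u) → Commute g s := by
  have := hS.finiteDimensional
  -- With this sign 1 + t = -u², so s = (1 + t)^(-1/2) gives (us)² = -1, and s agrees with 1 on `S`
  -- because t vanishes there.
  set t : DualAlgebra ℝ C := -(u * u + 1) with ht
  have htS : ∀ c ∈ S, t c = 0 := fun c hc => by
    rw [ht, WithConv.ofConv_neg, LinearMap.neg_apply, hu c hc, neg_zero]
  have hnil := hS.isLocallyNilpotent hC htS
  obtain ⟨q, hq, hq0⟩ := PowerSeries.exists_mul_self_mul_one_add_X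
  have hcomm : ∀ g, Commute g (u * u) → Commute g (substHom hnil q) := fun g hg =>
    commute_substHom hnil ((hg.add_right (Commute.one_right g)).neg_right) q
  have hsub := fun c hc => substHom_apply_of_forall_eq_zero hnil q hq0 fun f =>
    hC.mul_apply_eq_zero hS.isRightCoideal htS f c hc
  have h1 := congrArg (substHom hnil) hq
  rw [map_mul, map_mul, map_add, map_one, substHom_X] at h1
  generalize substHom hnil q = s at hcomm hsub h1
  refine ⟨s, ?_, fun c hc => ?_, hcomm⟩
  · exact mul_mul_mul_eq_neg_one (hcomm u (by simp [Commute, SemiconjBy, mul_assoc])).eq h1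
  · have h2 := hC.mul_apply_eq_zero hS.isRightCoideal hsub u c hc
    rwa [mul_sub, mul_one, WithConv.ofConv_sub, LinearMap.sub_apply, sub_eq_zero] at h2

/-- The ideal of functionals that vanish on a finite-dimensional right coideal. -/
def IsChainCoalgebra.annihilator (hC : IsChainCoalgebra ℝ C) (hS : IsRightCoideal ℝ S)
    [FiniteDimensional ℝ S] : Ideal (DualAlgebra ℝ C) where
  carrier := {f | ∀ c ∈ S, f c = 0}
  zero_mem' _ _ := rfl
  add_mem' {f g} hf hg c hc := by
    rw [WithConv.ofConv_add, LinearMap.add_apply, hf c hc, hg c hc, add_zero]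
  smul_mem' f g hg := hC.mul_apply_eq_zero hS hg f

instance (hC : IsChainCoalgebra ℝ C) (hS : IsRightCoideal ℝ S) [FiniteDimensional ℝ S] :
    (hC.annihilator hS).IsTwoSided :=
  ⟨fun g hf => hS.mul_apply_eq_zero hf g⟩

lemma IsChainCoalgebra.sub_mem_annihilator (hC : IsChainCoalgebra ℝ C) (hS : IsRightCoideal ℝ S)
    [FiniteDimensional ℝ S] {f g : DualAlgebra ℝ C} :
    f - g ∈ hC.annihilator hS ↔ ∀ c ∈ S, f c = g c := by
  refine forall₂_congr fun c hc => ?_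
  rw [WithConv.ofConv_sub, LinearMap.sub_apply, sub_eq_zero]

instance (hC : IsChainCoalgebra ℝ C) (hS : IsRightCoideal ℝ S) [FiniteDimensional ℝ S] :
    FiniteDimensional ℝ (DualAlgebra ℝ C ⧸ hC.annihilator hS) := by
  let ψ : DualAlgebra ℝ C →ₗ[ℝ] Module.Dual ℝ S :=
    { toFun := fun f => f.ofConv ∘ₗ S.subtype
      map_add' := fun _ _ => rfl
      map_smul' := fun _ _ => rfl }
  have hψ : LinearMap.ker ψ = (hC.annihilator hS).restrictScalars ℝ := by
    ext f
    exact ⟨fun h c hc => LinearMap.congr_fun h ⟨c, hc⟩, fun h => LinearMap.ext fun c => h c c.2⟩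
  have h1 : Module.Finite ℝ (DualAlgebra ℝ C ⧸ LinearMap.ker ψ) :=
    Module.Finite.equiv ψ.quotKerEquivRange.symm
  rw [hψ] at h1
  exact Module.Finite.equiv (Submodule.Quotient.restrictScalarsEquiv ℝ (hC.annihilator hS))

lemma IsSmallestCoideal.nontrivial_quotient (hC : IsChainCoalgebra ℝ C) (hS : IsSmallestCoideal S)
    [FiniteDimensional ℝ S] :
    Nontrivial (DualAlgebra ℝ C ⧸ hC.annihilator hS.isRightCoideal) := by
  rw [Ideal.Quotient.nontrivial_iff]
  intro h
  obtain ⟨s, hs, hs0⟩ := Submodule.exists_mem_ne_zero_of_ne_bot hS.lt.ne'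
  refine hs0 (ext_of_forall_apply (k := ℝ) fun f => ?_)
  have hf : f ∈ hC.annihilator hS.isRightCoideal := h ▸ Submodule.mem_top
  rw [hf s hs, map_zero]

/-- Every nonzero class has a right inverse. -/
lemma IsSmallestCoideal.noZeroDivisors_quotient (hC : IsChainCoalgebra ℝ C)
    (hS : IsSmallestCoideal S) [FiniteDimensional ℝ S] :
    NoZeroDivisors (DualAlgebra ℝ C ⧸ hC.annihilator hS.isRightCoideal) := by
  refine ⟨fun {a b} hab => ?_⟩
  by_cases hb : b = 0
  · exact Or.inr hb
  left
  obtain ⟨g, rfl⟩ := Ideal.Quotient.mk_surjective b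
  have hg : ∃ s ∈ S, g s ≠ 0 := by
    by_contra! h
    exact hb (Ideal.Quotient.eq_zero_iff_mem.2 h)
  obtain ⟨s, hs, hgs⟩ := hg
  obtain ⟨g', hg'⟩ := hS.exists_mul_eq_one hC hs hgs
  have h1 := Ideal.Quotient.eq.2 ((hC.sub_mem_annihilator hS.isRightCoideal).2 hg')
  rw [map_mul, map_one] at h1
  rw [← mul_one a, ← h1, ← mul_assoc, hab, zero_mul]

end Lifting

/-! ### Lifting division algebras from quotients -/

section RingLifting

variable {R : Type*} [Ring R] [Algebra ℝ R]

/-- First replace `j` by its part anticommuting with `i`, which is congruent to `j` modulo `J`. The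
correction `s` that then makes the square exactly -1 commutes with `i`, since `i` commutes with u²,
so anticommutation survives. -/
lemma exists_lift_anticommuting {J : Ideal R} [J.IsTwoSided]
    (hlift : ∀ u : R, u * u + 1 ∈ J → ∃ s, u * s * (u * s) = -1 ∧ u * s - u ∈ J ∧
      ∀ g, Commute g (u * u) → Commute g s)
    {i j : R} (hi : i * i = -1) (hj : j * j + 1 ∈ J) (hij : i * j + j * i ∈ J) :
    ∃ j', j' * j' = -1 ∧ i * j' = -(j' * i) ∧ j' - j ∈ J := by
  have hi' : ∀ u : R, i * (i * u) = -u := fun u => by rw [← mul_assoc, hi, neg_one_mul]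
  set u : R := (1 / 2 : ℝ) • (j + i * j * i) with hu
  have hui : i * u = -(u * i) := by
    simp only [hu, mul_smul_comm, smul_mul_assoc, mul_add, add_mul, mul_assoc, hi', hi, mul_neg,
      mul_one]
    module
  have huj : u - j ∈ J := by
    have : u - j = (1 / 2 : ℝ) • ((i * j + j * i) * i) := by
      simp only [hu, add_mul, mul_assoc, hi, mul_neg, mul_one]
      module
    rw [this, Algebra.smul_def]
    exact J.mul_mem_left _ (J.mul_mem_right _ hij)
  have huu : u * u + 1 ∈ J := by
    have : u * u + 1 = u * (u - j) + (u - j) * j + (j * j + 1) := by noncomm_ring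
    rw [this]
    exact J.add_mem (J.add_mem (J.mul_mem_left _ huj) (J.mul_mem_right _ huj)) hj
  obtain ⟨s, h1, h2, h3⟩ := hlift u huu
  have his : i * s = s * i := (h3 i (by
    rw [Commute, SemiconjBy, ← mul_assoc, hui, neg_mul, mul_assoc, hui, mul_neg, neg_neg,
      mul_assoc])).eq
  refine ⟨u * s, h1, ?_, ?_⟩
  · rw [← mul_assoc, hui, neg_mul, mul_assoc, his, mul_assoc]
  · have := J.add_mem h2 huj
    rwa [sub_add_sub_cancel] at this

/-- If square roots of `-1` can be lifted modulo `J` and `R ⧸ J` is a finite-dimensional division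
algebra, then `R ⧸ J` lifts to a copy of `ℝ`, `ℂ` or `ℍ` in `R`. -/
lemma exists_lift_division_algebra (J : Ideal R) [J.IsTwoSided] [Nontrivial (R ⧸ J)]
    [NoZeroDivisors (R ⧸ J)] [FiniteDimensional ℝ (R ⧸ J)]
    (hlift : ∀ u : R, u * u + 1 ∈ J → ∃ s, u * s * (u * s) = -1 ∧ u * s - u ∈ J ∧
      ∀ g, Commute g (u * u) → Commute g s) :
    (∀ f : R, ∃ x : ℝ, x • 1 - f ∈ J) ∨
      (∃ i : R, i * i = -1 ∧ ∀ f : R, ∃ x y : ℝ, x • 1 + y • i - f ∈ J) ∨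
      (∃ i j : R, i * i = -1 ∧ j * j = -1 ∧ i * j = -(j * i) ∧
        ∀ f : R, ∃ x y z w : ℝ, x • 1 + y • i + z • j + w • (i * j) - f ∈ J) := by
  have hsmul : ∀ (r : ℝ) (f : R),
      Ideal.Quotient.mk J (r • f) = r • Ideal.Quotient.mk J f := fun _ _ => rfl
  have hneg : ∀ f : R, Ideal.Quotient.mk J f * Ideal.Quotient.mk J f = -1 →
      f * f + 1 ∈ J := fun f hf => by
    rw [← Ideal.Quotient.eq_zero_iff_mem, map_add, map_mul, hf, map_one, neg_add_cancel]
  have hlift' : ∀ i : R ⧸ J, i * i = -1 → ∃ i' : R, i' * i' = -1 ∧ Ideal.Quotient.mk J i' = i := by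
    intro i hi
    obtain ⟨i, rfl⟩ := Ideal.Quotient.mk_surjective i
    obtain ⟨s, h1, h2, -⟩ := hlift i (hneg i hi)
    exact ⟨i * s, h1, Ideal.Quotient.eq.2 h2⟩
  rcases frobenius_real_division_algebra (R ⧸ J) with h | ⟨i, hi, h⟩ | ⟨i, j, hi, hj, hij, h⟩
  · refine Or.inl fun f => ?_
    obtain ⟨x, hx⟩ := h (Ideal.Quotient.mk J f)
    exact ⟨x, Ideal.Quotient.eq.1 (by rw [hx, hsmul, map_one])⟩
  · obtain ⟨i, hi1, rfl⟩ := hlift' i hi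
    refine Or.inr (Or.inl ⟨i, hi1, fun f => ?_⟩)
    obtain ⟨x, y, hx⟩ := h (Ideal.Quotient.mk J f)
    exact ⟨x, y, Ideal.Quotient.eq.1 (by rw [hx, map_add, hsmul, hsmul, map_one])⟩
  · obtain ⟨i, hi1, rfl⟩ := hlift' i hi
    obtain ⟨j, rfl⟩ := Ideal.Quotient.mk_surjective j
    obtain ⟨j', hj', hij', hjj'⟩ := exists_lift_anticommuting hlift hi1 (hneg j hj) (by
      rw [← Ideal.Quotient.eq_zero_iff_mem, map_add, map_mul, map_mul, hij, neg_add_cancel])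
    rw [← Ideal.Quotient.eq.2 hjj'] at h
    refine Or.inr (Or.inr ⟨i, j', hi1, hj', hij', fun f => ?_⟩)
    obtain ⟨x, y, z, w, hx⟩ := h (Ideal.Quotient.mk J f)
    exact ⟨x, y, z, w, Ideal.Quotient.eq.1 (by
      simp only [hx, map_add, hsmul, map_one, map_mul])⟩

omit [Algebra ℝ R] in
lemma mul_mul_eq_neg_of_mul_self_eq_neg_one {x v : R} (hv : v * v = -1) : x * v * v = -x := by
  rw [mul_assoc, hv, mul_neg_one]

-- The two candidates are twice the components of `y` on which conjugation by `i` acts as 1 and -1.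
-- In the application `P` says that x vanishes on S but not on T.
omit [Algebra ℝ R] in
lemma exists_commute_or_anticommute {P : R → Prop} {i : R} (hi : i * i = -1)
    (hP : ∀ x, P x → P (x - i * x * i) ∨ P (x + i * x * i)) {y : R} (hy : P y) :
    ∃ x, P x ∧ (x * i = i * x ∨ x * i = -(i * x)) := by
  have hi' : ∀ u : R, i * (i * u) = -u := fun u => by rw [← mul_assoc, hi, neg_one_mul]
  rcases hP y hy with h | h
  · refine ⟨_, h, Or.inl ?_⟩
    simp only [mul_sub, sub_mul, mul_assoc, hi', hi, mul_neg, mul_one]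
    abel
  · refine ⟨_, h, Or.inr ?_⟩
    simp only [mul_add, add_mul, mul_assoc, hi', hi, mul_neg, mul_one]
    abel

-- Anticommutation with one generator is repaired by multiplying with the other one. This is why no
-- twisted quaternionic case arises.
omit [Algebra ℝ R] in
lemma exists_commute_both {P : R → Prop} {i j : R} (hi : i * i = -1) (hj : j * j = -1)
    (hij : i * j = -(j * i))
    (hP : ∀ v, v * v = -1 → ∀ x, P x → P (x - v * x * v) ∨ P (x + v * x * v))
    (hP' : ∀ v, v * v = -1 → ∀ x, P x → P (x * v)) {y : R} (hy : P y) :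
    ∃ x, P x ∧ x * i = i * x ∧ x * j = j * x := by
  have h1 : ∃ x, P x ∧ x * i = i * x := by
    obtain ⟨x, hx, h | h⟩ := exists_commute_or_anticommute hi (hP i hi) hy
    · exact ⟨x, hx, h⟩
    · refine ⟨x * j, hP' j hj x hx, ?_⟩
      rw [← mul_assoc, ← neg_eq_iff_eq_neg.2 h, mul_assoc, neg_mul, mul_assoc, hij, mul_neg,
        neg_neg]
  obtain ⟨x, hx, hxi⟩ := h1
  have h2 : ∃ x, (P x ∧ x * i = i * x) ∧ (x * j = j * x ∨ x * j = -(j * x)) := by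
    -- The second splitting stays in the centralizer of `i`, which conjugation by `j` preserves.
    refine exists_commute_or_anticommute (P := fun x => P x ∧ x * i = i * x) hj ?_ ⟨hx, hxi⟩
    rintro x ⟨hx, hxi⟩
    have h3 : j * x * j * i = i * (j * x * j) := by
      calc j * x * j * i = j * x * (j * i) := mul_assoc _ _ _
        _ = -(j * (x * i) * j) := by
          rw [← neg_eq_iff_eq_neg.2 hij]
          simp only [mul_neg, mul_assoc]
        _ = i * j * x * j := by
          rw [hxi, hij]
          simp only [neg_mul, mul_assoc]
        _ = i * (j * x * j) := by simp only [mul_assoc]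
    refine (hP j hj x hx).imp (fun h => ⟨h, ?_⟩) fun h => ⟨h, ?_⟩
    · rw [sub_mul, mul_sub, hxi, h3]
    · rw [add_mul, mul_add, hxi, h3]
  obtain ⟨x, ⟨hx, hxi⟩, h | h⟩ := h2
  · exact ⟨x, hx, hxi, h⟩
  · refine ⟨x * i, hP' i hi x hx, by rw [hxi, mul_assoc, hxi], ?_⟩
    rw [← mul_assoc, ← neg_eq_iff_eq_neg.2 h, mul_assoc, neg_mul, mul_assoc, hij, mul_neg]

end RingLifting

/-! ### Power series as skew power series -/

/-- Power series are skew power series for the identity automorphism. -/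
def SkewPowerSeries.reflEquiv (k D : Type*) [Field k] [Ring D] [Algebra k D] :
    SkewPowerSeries (AlgEquiv.refl : D ≃ₐ[k] D) ≃ₐ[k] PowerSeries D :=
  AlgEquiv.ofLinearEquiv
    { toFun := fun b => PowerSeries.mk b.coeff
      invFun := fun p => ⟨fun n => PowerSeries.coeff n p⟩
      map_add' := fun a b => by ext n; simp
      map_smul' := fun r b => by ext n; simp
      left_inv := fun b => by ext n; simp
      right_inv := fun p => by ext n; simp }
    (by ext n; simp [PowerSeries.coeff_one, SkewPowerSeries.coeff_one])
    (fun a b => by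
      ext n
      have h : ∀ m, (AlgEquiv.refl : D ≃ₐ[k] D) ^ m = 1 := fun m => one_pow m
      simp [PowerSeries.coeff_mul, SkewPowerSeries.coeff_mul, h])

/-! ### The classification -/

section Classification

open DualAlgebra

variable {C : Type*} [AddCommGroup C] [Module ℝ C] [Coalgebra ℝ C]

lemma exists_mul_eq_one_of_divisionRing {D : Type*} [DivisionRing D] (w : D) (hw : w ≠ 0) :
    ∃ v, v * w = 1 := ⟨w⁻¹, inv_mul_cancel₀ hw⟩

lemma isFiniteDual_powerSeries (D : Type*) [Ring D] [Algebra ℝ D] [FiniteDimensional ℝ D] :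
    SkewPowerSeries.IsFiniteDual ((finiteDual.evalHom ℝ (PowerSeries D)).comp
      (SkewPowerSeries.reflEquiv ℝ D).toAlgHom) :=
  SkewPowerSeries.isFiniteDual_finiteDual (SkewPowerSeries.reflEquiv ℝ D)

lemma isFiniteDual_skewComplex :
    SkewPowerSeries.IsFiniteDual ((finiteDual.evalHom ℝ (SkewPowerSeries Complex.conjAe)).comp
      (AlgEquiv.refl : SkewPowerSeries Complex.conjAe ≃ₐ[ℝ] _).toAlgHom) :=
  SkewPowerSeries.isFiniteDual_finiteDual AlgEquiv.refl

lemma isChainCoalgebra_powerSeries (D : Type*) [DivisionRing D] [Algebra ℝ D]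
    [FiniteDimensional ℝ D] : IsChainCoalgebra ℝ (finiteDual ℝ (PowerSeries D)) :=
  (isFiniteDual_powerSeries D).isChainCoalgebra exists_mul_eq_one_of_divisionRing

lemma isChainCoalgebra_skewComplex : IsChainCoalgebra ℝ SkewComplexSeriesDual :=
  isFiniteDual_skewComplex.isChainCoalgebra exists_mul_eq_one_of_divisionRing

lemma not_finiteDimensional_powerSeries (D : Type*) [DivisionRing D] [Algebra ℝ D]
    [FiniteDimensional ℝ D] : ¬ FiniteDimensional ℝ (finiteDual ℝ (PowerSeries D)) :=
  (isFiniteDual_powerSeries D).not_finiteDimensional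

lemma not_finiteDimensional_skewComplex : ¬ FiniteDimensional ℝ SkewComplexSeriesDual :=
  isFiniteDual_skewComplex.not_finiteDimensional

/-- Every infinite-dimensional real chain coalgebra is one of the four. -/
theorem classification_of_chain_coalgebras (hinf : ¬ FiniteDimensional ℝ C)
    (hC : IsChainCoalgebra ℝ C) :
    Nonempty (C ≃ₗc[ℝ] RealSeriesDual) ∨ Nonempty (C ≃ₗc[ℝ] ComplexSeriesDual) ∨
      Nonempty (C ≃ₗc[ℝ] SkewComplexSeriesDual) ∨ Nonempty (C ≃ₗc[ℝ] QuaternionSeriesDual) := by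
  obtain ⟨S, hS⟩ := hC.exists_isNextCoideal hinf isRightCoideal_bot
  have := hS.finiteDimensional
  obtain ⟨T, hT⟩ := hC.exists_isNextCoideal hinf hS.isRightCoideal
  have := hT.finiteDimensional
  have := IsSmallestCoideal.nontrivial_quotient hC hS
  have := IsSmallestCoideal.noZeroDivisors_quotient hC hS
  have hJ {f g : DualAlgebra ℝ C} := hC.sub_mem_annihilator hS.isRightCoideal (f := f) (g := g)
  let P : DualAlgebra ℝ C → Prop := fun x => (∀ c ∈ S, x c = 0) ∧ ∃ d ∈ T, x d ≠ 0
  obtain ⟨y, hy⟩ : ∃ y, P y := by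
    obtain ⟨d, hd, hdS⟩ := SetLike.exists_of_lt hT.lt
    obtain ⟨y, hyd, hy⟩ := Submodule.exists_dual_map_eq_bot_of_notMem hdS inferInstance
    refine ⟨WithConv.toConv y, fun c hc => ?_, d, hd, hyd⟩
    exact (Submodule.mem_bot ℝ).1 (hy ▸ Submodule.mem_map_of_mem hc)
  have hP : ∀ v : DualAlgebra ℝ C, v * v = -1 → ∀ x, P x →
      P (x - v * x * v) ∨ P (x + v * x * v) := by
    rintro v - x ⟨hx, d, hd, hxd⟩
    have h0 : ∀ c ∈ S, (v * x * v) c = 0 := hS.isRightCoideal.mul_apply_eq_zero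
      (hC.mul_apply_eq_zero hS.isRightCoideal hx v) v
    -- The two values at `d` add up to 2x(d) ≠ 0, so they are not both zero.
    by_cases h : (x - v * x * v) d = 0
    · refine Or.inr ⟨fun c hc => ?_, d, hd, fun h' => hxd ?_⟩
      · rw [WithConv.ofConv_add, LinearMap.add_apply, hx c hc, h0 c hc, add_zero]
      · rw [WithConv.ofConv_sub, LinearMap.sub_apply] at h
        rw [WithConv.ofConv_add, LinearMap.add_apply] at h'
        linarith
    · refine Or.inl ⟨fun c hc => ?_, d, hd, h⟩
      rw [WithConv.ofConv_sub, LinearMap.sub_apply, hx c hc, h0 c hc, sub_zero]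
  have hP' : ∀ v : DualAlgebra ℝ C, v * v = -1 → ∀ x, P x → P (x * v) := by
    rintro v hv x ⟨hx, d, hd, hxd⟩
    refine ⟨hS.isRightCoideal.mul_apply_eq_zero hx v, ?_⟩
    by_contra! h
    -- If xv vanished on `T`, so would xvv = -x.
    have h1 := hT.isRightCoideal.mul_apply_eq_zero h v d hd
    rw [mul_mul_eq_neg_of_mul_self_eq_neg_one hv] at h1
    exact hxd (neg_eq_zero.1 h1)
  have hnil : ∀ x, P x → x.IsLocallyNilpotent := fun x hx =>
    IsSmallestCoideal.isLocallyNilpotent hC hS hx.1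
  rcases exists_lift_division_algebra (hC.annihilator hS.isRightCoideal) (fun u hu => by
    obtain ⟨s, h1, h2, h3⟩ := IsSmallestCoideal.exists_mul_self_eq_neg_one hC hS hu
    exact ⟨s, h1, hJ.2 h2, h3⟩) with h | ⟨i, hi, h⟩ | ⟨i, j, hi, hj, hij, h⟩
  · left
    obtain ⟨d, hd, hyd⟩ := hy.2
    refine nonempty_coalgEquiv_finiteDual hinf (SkewPowerSeries.reflEquiv ℝ ℝ)
      (isChainCoalgebra_powerSeries ℝ) hT (Algebra.ofId ℝ _) (fun f => ?_) (hnil y hy) hd hyd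
      fun w => (Algebra.commutes w y).symm
    obtain ⟨x, hx⟩ := h f
    refine ⟨x, hJ.1 ?_⟩
    rwa [Algebra.ofId_apply, Algebra.algebraMap_eq_smul_one]
  · have hι : ∀ f : DualAlgebra ℝ C, ∃ w, ∀ c ∈ S, (Complex.liftAux i hi w) c = f c := fun f => by
      obtain ⟨x, y, hxy⟩ := h f
      refine ⟨⟨x, y⟩, hJ.1 ?_⟩
      rwa [Complex.liftAux_apply, Algebra.algebraMap_eq_smul_one]
    -- The commuting case yields ℂ[[x]], the anticommuting case the series twisted by conjugation.
    obtain ⟨x, hx, hxi | hxi⟩ := exists_commute_or_anticommute hi (hP i hi) hy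
    · right; left
      obtain ⟨d, hd, hxd⟩ := hx.2
      refine nonempty_coalgEquiv_finiteDual hinf (SkewPowerSeries.reflEquiv ℝ ℂ)
        (isChainCoalgebra_powerSeries ℂ) hT (Complex.liftAux i hi) hι (hnil x hx) hd hxd fun w => ?_
      change x * Complex.liftAux i hi w = Complex.liftAux i hi w * x
      rw [Complex.liftAux_apply, mul_add, add_mul, mul_smul_comm,
        smul_mul_assoc, hxi, Algebra.commutes]
    · right; right; left
      obtain ⟨d, hd, hxd⟩ := hx.2
      refine nonempty_coalgEquiv_finiteDual hinf AlgEquiv.refl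
        isChainCoalgebra_skewComplex hT (Complex.liftAux i hi) hι (hnil x hx) hd hxd fun w => ?_
      rw [Complex.liftAux_apply, Complex.liftAux_apply, mul_add, add_mul, mul_smul_comm,
        smul_mul_assoc, hxi, Complex.conjAe_coe, Complex.conj_re, Complex.conj_im,
        Algebra.commutes, neg_smul, smul_neg]
  · right; right; right
    let q : QuaternionAlgebra.Basis (DualAlgebra ℝ C) (-1 : ℝ) 0 (-1) :=
      { i := i
        j := j
        k := i * j
        i_mul_i := by rw [hi, neg_smul, one_smul, zero_smul, add_zero]
        j_mul_j := by rw [hj, neg_smul, one_smul]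
        i_mul_j := rfl
        j_mul_i := by rw [zero_smul, zero_sub, hij, neg_neg] }
    obtain ⟨x, hx, hxi, hxj⟩ := exists_commute_both hi hj hij hP hP' hy
    obtain ⟨d, hd, hxd⟩ := hx.2
    refine nonempty_coalgEquiv_finiteDual hinf (SkewPowerSeries.reflEquiv ℝ (Quaternion ℝ))
      (isChainCoalgebra_powerSeries (Quaternion ℝ)) hT q.liftHom (fun f => ?_) (hnil x hx) hd hxd
      fun w => ?_
    · obtain ⟨a, b, c, e, habce⟩ := h f
      refine ⟨⟨a, b, c, e⟩, hJ.1 ?_⟩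
      rwa [← Algebra.algebraMap_eq_smul_one] at habce
    · change x * (algebraMap ℝ _ w.re + w.imI • i + w.imJ • j + w.imK • (i * j)) =
        (algebraMap ℝ _ w.re + w.imI • i + w.imJ • j + w.imK • (i * j)) * x
      have hxij : x * (i * j) = i * j * x := by
        rw [← mul_assoc, hxi, mul_assoc, hxj, mul_assoc]
      simp only [mul_add, add_mul, mul_smul_comm, smul_mul_assoc, hxi, hxj, hxij,
        Algebra.commutes]

/-! ### Telling the four coalgebras apart -/

lemma isEmpty_coalgEquiv_powerSeries {D D' : Type*} [DivisionRing D] [Algebra ℝ D]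
    [FiniteDimensional ℝ D] [DivisionRing D'] [Algebra ℝ D'] [FiniteDimensional ℝ D']
    (h : Module.finrank ℝ D < Module.finrank ℝ D') :
    IsEmpty (finiteDual ℝ (PowerSeries D) ≃ₗc[ℝ] finiteDual ℝ (PowerSeries D')) :=
  ⟨fun e => h.not_ge <| (isFiniteDual_powerSeries D).finrank_le_of_coalgHom
    (isFiniteDual_powerSeries D') exists_mul_eq_one_of_divisionRing
    exists_mul_eq_one_of_divisionRing e.toCoalgHom e.injective⟩

lemma isEmpty_coalgEquiv_real_skewComplex :
    IsEmpty (RealSeriesDual ≃ₗc[ℝ] SkewComplexSeriesDual) :=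
  ⟨fun e => by
    have h := (isFiniteDual_powerSeries ℝ).finrank_le_of_coalgHom isFiniteDual_skewComplex
      exists_mul_eq_one_of_divisionRing exists_mul_eq_one_of_divisionRing e.toCoalgHom e.injective
    rw [Complex.finrank_real_complex, Module.finrank_self] at h
    lia⟩

lemma isEmpty_coalgEquiv_skewComplex_quaternion :
    IsEmpty (SkewComplexSeriesDual ≃ₗc[ℝ] QuaternionSeriesDual) :=
  ⟨fun e => by
    have h := isFiniteDual_skewComplex.finrank_le_of_coalgHom
      (isFiniteDual_powerSeries (Quaternion ℝ)) exists_mul_eq_one_of_divisionRing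
      exists_mul_eq_one_of_divisionRing e.toCoalgHom e.injective
    rw [Complex.finrank_real_complex, Quaternion.finrank_eq_four] at h
    lia⟩

/-- Both smallest coideals have dimension 2, so cocommutativity has to decide. -/
lemma isEmpty_coalgEquiv_complex_skewComplex :
    IsEmpty (ComplexSeriesDual ≃ₗc[ℝ] SkewComplexSeriesDual) :=
  ⟨fun e => by
    have h (a b : SkewPowerSeries Complex.conjAe) : a * b = b * a :=
      isFiniteDual_skewComplex.ext fun f =>
        finiteDual.apply_mul_comm_of_coalgEquiv mul_comm e f a b
    -- The coefficients of x in x · i and i · x are -i and i.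
    have h1 := congrArg (fun b => b.coeff 1) (h ⟨Pi.single 1 1⟩ ⟨Pi.single 0 Complex.I⟩)
    simp [SkewPowerSeries.coeff_mul, Finset.Nat.antidiagonal_succ] at h1
    have h2 := congrArg Complex.im h1
    norm_num at h2⟩

end Classification

end

theorem mainTheorem10 :
    -- each of the four coalgebras is an infinite-dimensional chain coalgebra
    ((¬ FiniteDimensional ℝ RealSeriesDual ∧ IsChainCoalgebra ℝ RealSeriesDual) ∧
      (¬ FiniteDimensional ℝ ComplexSeriesDual ∧ IsChainCoalgebra ℝ ComplexSeriesDual) ∧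
      (¬ FiniteDimensional ℝ SkewComplexSeriesDual ∧ IsChainCoalgebra ℝ SkewComplexSeriesDual) ∧
      (¬ FiniteDimensional ℝ QuaternionSeriesDual ∧ IsChainCoalgebra ℝ QuaternionSeriesDual)) ∧
    -- every infinite-dimensional real chain coalgebra is isomorphic to one of them
    (∀ (C : Type*) [AddCommGroup C] [Module ℝ C] [Coalgebra ℝ C],
      ¬ FiniteDimensional ℝ C → IsChainCoalgebra ℝ C →
        Nonempty (C ≃ₗc[ℝ] RealSeriesDual) ∨ Nonempty (C ≃ₗc[ℝ] ComplexSeriesDual) ∨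
          Nonempty (C ≃ₗc[ℝ] SkewComplexSeriesDual) ∨
          Nonempty (C ≃ₗc[ℝ] QuaternionSeriesDual)) ∧
    -- no two of the four are isomorphic
    (IsEmpty (RealSeriesDual ≃ₗc[ℝ] ComplexSeriesDual) ∧
      IsEmpty (RealSeriesDual ≃ₗc[ℝ] SkewComplexSeriesDual) ∧
      IsEmpty (RealSeriesDual ≃ₗc[ℝ] QuaternionSeriesDual) ∧
      IsEmpty (ComplexSeriesDual ≃ₗc[ℝ] SkewComplexSeriesDual) ∧
      IsEmpty (ComplexSeriesDual ≃ₗc[ℝ] QuaternionSeriesDual) ∧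
      IsEmpty (SkewComplexSeriesDual ≃ₗc[ℝ] QuaternionSeriesDual)) := by
  refine ⟨⟨⟨not_finiteDimensional_powerSeries ℝ, isChainCoalgebra_powerSeries ℝ⟩,
    ⟨not_finiteDimensional_powerSeries ℂ, isChainCoalgebra_powerSeries ℂ⟩,
    ⟨not_finiteDimensional_skewComplex, isChainCoalgebra_skewComplex⟩,
    ⟨not_finiteDimensional_powerSeries (Quaternion ℝ),
      isChainCoalgebra_powerSeries (Quaternion ℝ)⟩⟩,
    fun C _ _ _ hinf hC => classification_of_chain_coalgebras hinf hC,
    isEmpty_coalgEquiv_powerSeries ?_, isEmpty_coalgEquiv_real_skewComplex,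
    isEmpty_coalgEquiv_powerSeries ?_, isEmpty_coalgEquiv_complex_skewComplex,
    isEmpty_coalgEquiv_powerSeries ?_, isEmpty_coalgEquiv_skewComplex_quaternion⟩
  · rw [Complex.finrank_real_complex, Module.finrank_self]
    lia
  · rw [Quaternion.finrank_eq_four, Module.finrank_self]
    lia
  · rw [Quaternion.finrank_eq_four, Complex.finrank_real_complex]
    lia
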